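/- Conventions. All homeomorphisms $h:\mathbb T\to\mathbb T$ of the unit circle are normalized to fix $1,\mathfrak i,-1$ (hence preserve orientation). The Farey tessellation of the unit disk is the image, under the inverse of the Cayley map $\mathfrak c(z)=-\mathfrak i\frac{z+1}{z-1}$ (which sends $1,\mathfrak i,-1$ to $\infty,-1,0$), of the $\mathrm{PSL}(2,\mathbb Z)$-orbit of the geodesic $(0,\infty)$ of the upper half-plane. Let $E$ be its set of unoriented edges and $V$ its set of vertices. For $v\in V$ the edges incident to $v$ form the fan $\mathrm{fan}(v)=(e_n)_{n\in\mathbb Z}$, indexed in counterclockwise order: sending $v$ to $\infty$ by a conformal map of the disk onto the upper half-plane, the $e_n$ become equally spaced vertical lines, with $n$ increasing from left to right. Each $e=(a,c)\in E$ is the diagonal of the quadrilateral $(a,b,c,d)$ (counterclockwise) formed by the two tessellation triangles adjacent to $e$. The shear coordinate of $h$ is $s_h:E\to\mathbb R$, $$s_h(e)=\log \operatorname{cr}(h(a),h(b),h(c),h(d)),\qquad \operatorname{cr}(a,b,c,d)=\frac{(b-a)(d-c)}{(c-b)(d-a)} .$$ Let $\mathcal P$ be the set of functions $s:E\to\mathbb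 R$ such that, for every $v\in V$ with $\mathrm{fan}(v)=(e_n)_{n\in\mathbb Z}$, the limits $\lim_{n\to\infty}\sum_{k=-n}^{-1}s(e_k)$ and $\lim_{n\to\infty}\sum_{k=0}^{n}s(e_k)$ exist in $\mathbb R$. For $s\in\mathcal P$, $v\in V$ and $e\in\mathrm{fan}(v)$ let $p_{s,v}(e+)$ (resp. $p_{s,v}(e-)$) be the sum of $s$ over the edges of $\mathrm{fan}(v)$ of index strictly larger (resp. strictly smaller) than that of $e$, and define the diamond shear of $s$ on $e=(a,b)\in E$ by $$\Psi(s)(e)=\tfrac14\big(p_{s,a}(e-)-p_{s,a}(e+)+p_{s,b}(e-)-p_{s,b}(e+)\big).$$ Let $\mathcal H=\{s\in\mathcal P:\ \sum_{e\in E}\Psi(s)(e)^2<\infty\}$, and write $h\in\mathcal H$ to mean $s_h\in\mathcal H$. For $\alpha\in(0,1]$ let $\mathcal C^{1,\alpha}$ be the class of circle homeomorphisms $h$ that are everywhere differentiable with nonvanishing derivative $h'$ (with respect to arc length) and such that $\log h'$ is $\alpha$-Hölder on $\mathbb T$. Theorem. Let $\alpha\in(0,1]$. Then $\mathcal C^{1,\alpha}\subset\mathcal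 H$ if and only if $\alpha>1/2$. -/

import Mathlib

open Filter Topology
open scoped MatrixGroups NNReal

noncomputable section

namespace DiamondShear

/-! ### The Farey tessellation of the disk

The Cayley map `z ↦ -i (z + 1) / (z - 1)` carries the unit circle to `ℝ ∪ {∞}`, with
`1 ↦ ∞`, `i ↦ -1`, `-1 ↦ 0`; its inverse sends `p / q` to `(p - i q) / (p + i q)`. It carries the
edges of the Farey tessellation to the orbit of the geodesic `(∞, 0)` under `SL(2, ℤ)`. -/

lemma column_ne_zero (A : SL(2, ℤ)) : ((A 0 0 : ℂ) + (A 1 0 : ℂ) * Complex.I) ≠ 0 := by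
  intro h
  have hre := congrArg Complex.re h
  have him := congrArg Complex.im h
  simp at hre him
  have hd := A.det_coe
  rw [Matrix.det_fin_two] at hd
  simp [hre, him] at hd

/-- The Farey vertex on the unit circle whose image under the Cayley map is `A(∞) = p / q`, where
`(p, q)` is the first column of `A`, that is, the point `(p - i q) / (p + i q)`. -/
def vertex (A : SL(2, ℤ)) : Circle :=
  Circle.ofConjDivSelf ((A 0 0 : ℂ) + (A 1 0 : ℂ) * Complex.I) (column_ne_zero A)

/-- The (unoriented) Farey edge whose image under the Cayley map is the geodesic `(A(∞), A(0))`,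
recorded by its endpoints. Here `ModularGroup.S` is `z ↦ -1 / z`, which maps `∞` to `0`. -/
def edge (A : SL(2, ℤ)) : Sym2 Circle := s(vertex A, vertex (A * ModularGroup.S))

/-- The set `E` of edges of the Farey tessellation. -/
def fareyEdges : Set (Sym2 Circle) := Set.range edge

/-- `edge A` as an element of `E`. -/
def toEdge (A : SL(2, ℤ)) : fareyEdges := ⟨edge A, A, rfl⟩

/-- A matrix `A` representing the edge `e`, i.e. `e` is the edge between `A(∞)` and `A(0)`. -/
def rep (e : fareyEdges) : SL(2, ℤ) := e.2.choose

lemma toEdge_rep (e : fareyEdges) : toEdge (rep e) = e := Subtype.ext e.2.choose_spec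

/-! ### Shear coordinates -/

/-- The cross ratio of four points of the unit circle. -/
def crossRatio (a b c d : Circle) : ℂ :=
  (((b : ℂ) - a) * ((d : ℂ) - c)) / (((c : ℂ) - b) * ((d : ℂ) - a))

/-- The shear `log cr(a, b, c, d)` of the quad with cyclically ordered vertices `a, b, c, d` along
its diagonal `(a, c)`. The cross ratio of four cyclically ordered points of the circle is a positive
real number, hence equal to its modulus. -/
def shear (a b c d : Circle) : ℝ := Real.log ‖crossRatio a b c d‖

/-- The shear of the image under `h` of the Farey quad around `edge A`. The vertices of this quad in
counterclockwise order are `A(∞), A(-1), A(0), A(1)` (read through the Cayley map), where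
`ModularGroup.T` is `z ↦ z + 1`. -/
def shearAt (h : Circle ≃ₜ Circle) (A : SL(2, ℤ)) : ℝ :=
  shear (h (vertex A)) (h (vertex (A * ModularGroup.T⁻¹ * ModularGroup.S)))
    (h (vertex (A * ModularGroup.S))) (h (vertex (A * ModularGroup.T * ModularGroup.S)))

/-- The shear coordinate `s_h : E → ℝ` of a circle homeomorphism (see `shearCoord_toEdge` for the
independence of the chosen representative). -/
def shearCoord (h : Circle ≃ₜ Circle) (e : fareyEdges) : ℝ := shearAt h (rep e)

/-! ### Fans, diamond shears and the class of square summable diamond shears -/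

/-- The edges of the fan at the vertex `A(∞)`, indexed by `ℤ` counterclockwise: `fan A n` is the
edge between `A(∞)` and `A(n)`, so that `fan A 0 = toEdge A`. As `A` varies, all vertices and
all choices of the edge of index `0` occur. -/
def fan (A : SL(2, ℤ)) (n : ℤ) : fareyEdges := toEdge (A * ModularGroup.T ^ n)

/-- The class `𝒫` of shear functions all of whose half-fan sums converge. -/
def classP : Set (fareyEdges → ℝ) :=
  {s | ∀ A : SL(2, ℤ),
    (∃ L : ℝ, Tendsto (fun n : ℕ => ∑ k ∈ Finset.range n, s (fan A (-((k : ℤ) + 1))))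
      atTop (𝓝 L)) ∧
    (∃ L : ℝ, Tendsto (fun n : ℕ => ∑ k ∈ Finset.range n, s (fan A (k : ℤ))) atTop (𝓝 L))}

/-- `p_{s,v}(e+)` for `v = A(∞)`, `e = edge A`: the sum of `s` over the edges of the fan at `v` of
index strictly larger than that of `e`. -/
def pPlus (s : fareyEdges → ℝ) (A : SL(2, ℤ)) : ℝ :=
  limUnder atTop (fun n : ℕ => ∑ k ∈ Finset.range n, s (fan A ((k : ℤ) + 1)))

/-- `p_{s,v}(e-)` for `v = A(∞)`, `e = edge A`: the sum of `s` over the edges of the fan at `v` of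
index strictly smaller than that of `e`. -/
def pMinus (s : fareyEdges → ℝ) (A : SL(2, ℤ)) : ℝ :=
  limUnder atTop (fun n : ℕ => ∑ k ∈ Finset.range n, s (fan A (-((k : ℤ) + 1))))

/-- The diamond shear of `s` on `edge A`, whose endpoints are `A(∞)` and `A(0) = (A S)(∞)`. -/
def diamondAt (s : fareyEdges → ℝ) (A : SL(2, ℤ)) : ℝ :=
  1 / 4 * (pMinus s A - pPlus s A
    + pMinus s (A * ModularGroup.S) - pPlus s (A * ModularGroup.S))

/-- The diamond shear function `Ψ(s)` of a shear function `s ∈ 𝒫` (see `diamond_toEdge` for the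
independence of the chosen representative). -/
def diamond (s : fareyEdges → ℝ) (e : fareyEdges) : ℝ := diamondAt s (rep e)

/-- The class `ℋ` of shear functions in `𝒫` with square summable diamond shears. -/
def classH : Set (fareyEdges → ℝ) :=
  {s | s ∈ classP ∧ Summable (fun e : fareyEdges => diamond s e ^ 2)}

/-! ### Classes of circle homeomorphisms -/

/-- Normalized circle homeomorphisms: those that fix `1`, `i` and `-1` (in particular they preserve
the orientation). -/
def IsNormalized (h : Circle ≃ₜ Circle) : Prop :=
  ∀ z : Circle, (z : ℂ) = 1 ∨ (z : ℂ) = Complex.I ∨ (z : ℂ) = -1 → h z = z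

/-- The derivative `h'` of a circle homeomorphism with respect to arc length, i.e.
`φ'(θ) = |h'(e^{iθ})|` where `h(e^{iθ}) = e^{iφ(θ)}`. -/
def circleDeriv (h : Circle ≃ₜ Circle) (z : Circle) : ℝ :=
  ‖deriv (fun t : ℝ => (h (z * Circle.exp t) : ℂ)) 0‖

/-- The class `𝒞^{1,α}`: the normalized circle homeomorphisms that are everywhere differentiable
with nonvanishing derivative and with `log h'` an `α`-Hölder function. -/
def holderClass (α : ℝ≥0) : Set (Circle ≃ₜ Circle) :=
  {h | IsNormalized h ∧
    (∀ z : Circle, DifferentiableAt ℝ (fun t : ℝ => (h (z * Circle.exp t) : ℂ)) 0) ∧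
    (∀ z : Circle, circleDeriv h z ≠ 0) ∧
    ∃ C : ℝ≥0, HolderWith C α (fun z : Circle => Real.log (circleDeriv h z))}

/-- The class of normalized circle homeomorphisms `h` with `s_h ∈ ℋ`. -/
def diamondClass : Set (Circle ≃ₜ Circle) :=
  {h | IsNormalized h ∧ shearCoord h ∈ classH}

/-! ### Independence of representatives -/

lemma vertex_eq_iff (A B : SL(2, ℤ)) :
    vertex A = vertex B ↔ A 0 0 * B 1 0 = B 0 0 * A 1 0 := by
  have hA := column_ne_zero A
  have hB := column_ne_zero B
  have hA' := (map_ne_zero (starRingEnd ℂ)).2 hA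
  rw [vertex, vertex, Circle.ext_iff]
  change (starRingEnd ℂ) _ / _ = (starRingEnd ℂ) _ / _ ↔ _
  rw [div_eq_div_iff hA hB, Complex.ext_iff]
  simp
  constructor
  · rintro ⟨-, h⟩
    have : ((A 0 0 * B 1 0 : ℤ) : ℝ) = ((B 0 0 * A 1 0 : ℤ) : ℝ) := by
      push_cast; linarith
    exact_mod_cast this
  · intro h
    have : (A 0 0 * B 1 0 : ℝ) = (B 0 0 * A 1 0 : ℝ) := by exact_mod_cast h
    constructor <;> linarith

lemma vertex_neg (A : SL(2, ℤ)) : vertex (-A) = vertex A := by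
  rw [vertex_eq_iff]; simp [Matrix.SpecialLinearGroup.coe_neg]

lemma columns_eq {p q r t : ℤ} (x y x' y' : ℤ) (h : p * t = r * q)
    (h1 : p * y - x * q = 1) (h2 : r * y' - x' * t = 1) :
    (r = p ∧ t = q) ∨ (r = -p ∧ t = -q) := by
  have hr : r = p * (r * y - x * t) := by linear_combination (-r) * h1 + x * h
  have ht : t = q * (r * y - x * t) := by linear_combination (-t) * h1 + y * h
  have hu : (r * y - x * t) * (p * y' - x' * q) = 1 := by
    have h3 : (p * y' - x' * q) * (r * y - x * t)
        = (p * (r * y - x * t)) * y' - x' * (q * (r * y - x * t)) := by ring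
    rw [mul_comm, h3, ← hr, ← ht, h2]
  rcases Int.isUnit_iff.1 (IsUnit.of_mul_eq_one _ hu) with hk | hk <;> rw [hk] at hr ht
  · left; constructor <;> linarith
  · right; constructor <;> linarith

lemma mul_S_zero (A : SL(2, ℤ)) : (A * ModularGroup.S) 0 0 = A 0 1 := by
  simp [Matrix.SpecialLinearGroup.coe_mul, ModularGroup.coe_S, Matrix.mul_apply]

lemma mul_S_one (A : SL(2, ℤ)) : (A * ModularGroup.S) 1 0 = A 1 1 := by
  simp [Matrix.SpecialLinearGroup.coe_mul, ModularGroup.coe_S, Matrix.mul_apply]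

lemma eq_or_neg_of_vertices {A B : SL(2, ℤ)} (h : vertex A = vertex B)
    (h' : vertex (A * ModularGroup.S) = vertex (B * ModularGroup.S)) : B = A ∨ B = -A := by
  rw [vertex_eq_iff] at h h'
  have hA := A.det_coe
  have hB := B.det_coe
  rw [Matrix.det_fin_two] at hA hB
  simp only [mul_S_zero, mul_S_one] at h'
  have h1 := columns_eq (p := A 0 0) (q := A 1 0) (r := B 0 0) (t := B 1 0)
    (A 0 1) (A 1 1) (B 0 1) (B 1 1) h hA hB
  have h2 := columns_eq (p := A 0 1) (q := A 1 1) (r := B 0 1) (t := B 1 1)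
    (-A 0 0) (-A 1 0) (-B 0 0) (-B 1 0) (by linarith) (by linarith) (by linarith)
  rcases h1 with ⟨a, b⟩ | ⟨a, b⟩ <;> rcases h2 with ⟨c, d⟩ | ⟨c, d⟩
  · left; ext i j; fin_cases i <;> fin_cases j <;> simp [a, b, c, d]
  · exfalso; rw [a, b, c, d] at hB; linarith
  · exfalso; rw [a, b, c, d] at hB; linarith
  · right; ext i j; fin_cases i <;> fin_cases j <;>
      simp [a, b, c, d, Matrix.SpecialLinearGroup.coe_neg]

lemma S_mul_S : ModularGroup.S * ModularGroup.S = -1 := by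
  ext i j; fin_cases i <;> fin_cases j <;>
    simp [ModularGroup.coe_S, Matrix.SpecialLinearGroup.coe_neg,
      Matrix.SpecialLinearGroup.coe_mul]

lemma mul_S_mul_S (A : SL(2, ℤ)) : A * ModularGroup.S * ModularGroup.S = -A := by
  rw [mul_assoc, S_mul_S, mul_neg, mul_one]

/-- Two matrices represent the same edge only if they differ by a power of `S` on the right. -/
lemma edge_eq {A B : SL(2, ℤ)} (h : edge A = edge B) :
    (B = A ∨ B = -A) ∨ (B = A * ModularGroup.S ∨ B = -(A * ModularGroup.S)) := by
  rcases Sym2.eq_iff.1 h with ⟨h1, h2⟩ | ⟨h1, h2⟩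
  · exact Or.inl (eq_or_neg_of_vertices h1 h2)
  · refine Or.inr (eq_or_neg_of_vertices h2 ?_)
    rw [mul_S_mul_S, vertex_neg, h1]

lemma fan_neg (A : SL(2, ℤ)) (n : ℤ) : fan (-A) n = fan A n := by
  apply Subtype.ext
  simp only [fan, toEdge, edge, neg_mul, vertex_neg]

lemma shearAt_neg (h : Circle ≃ₜ Circle) (A : SL(2, ℤ)) : shearAt h (-A) = shearAt h A := by
  simp only [shearAt, neg_mul, vertex_neg]

lemma shearAt_mul_S (h : Circle ≃ₜ Circle) (A : SL(2, ℤ)) :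
    shearAt h (A * ModularGroup.S) = shearAt h A := by
  have e1 : vertex (A * ModularGroup.S * ModularGroup.T⁻¹ * ModularGroup.S)
      = vertex (A * ModularGroup.T * ModularGroup.S) := by
    rw [vertex_eq_iff]
    simp [ModularGroup.coe_S, ModularGroup.coe_T,
      Matrix.SpecialLinearGroup.coe_mul, Matrix.mul_apply, Fin.sum_univ_two]
    ring
  have e2 : vertex (A * ModularGroup.S * ModularGroup.T * ModularGroup.S)
      = vertex (A * ModularGroup.T⁻¹ * ModularGroup.S) := by
    rw [vertex_eq_iff]
    simp [ModularGroup.coe_S, ModularGroup.coe_T,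
      Matrix.SpecialLinearGroup.coe_mul, Matrix.mul_apply, Fin.sum_univ_two]
    ring
  rw [shearAt, e1, e2, mul_S_mul_S, vertex_neg, shearAt, shear, shear, crossRatio, crossRatio]
  congr 2
  rw [mul_comm (_ - _ : ℂ) (_ - _), ← neg_mul_neg (_ - _ : ℂ) (_ - _ : ℂ)]
  ring_nf

/-- The shear coordinate does not depend on the matrix representing the edge. -/
theorem shearCoord_toEdge (h : Circle ≃ₜ Circle) (A : SL(2, ℤ)) :
    shearCoord h (toEdge A) = shearAt h A := by
  have := edge_eq (congrArg Subtype.val (toEdge_rep (toEdge A))).symm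
  rw [shearCoord]
  rcases this with (e | e) | (e | e) <;> rw [e] <;> simp only [shearAt_neg, shearAt_mul_S]

lemma diamondAt_neg (s : fareyEdges → ℝ) (A : SL(2, ℤ)) : diamondAt s (-A) = diamondAt s A := by
  simp only [diamondAt, pMinus, pPlus, neg_mul, fan_neg]

lemma diamondAt_mul_S (s : fareyEdges → ℝ) (A : SL(2, ℤ)) :
    diamondAt s (A * ModularGroup.S) = diamondAt s A := by
  simp only [diamondAt, mul_S_mul_S, pMinus, pPlus, fan_neg]
  ring

/-- The diamond shear does not depend on the matrix representing the edge. -/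
theorem diamond_toEdge (s : fareyEdges → ℝ) (A : SL(2, ℤ)) :
    diamond s (toEdge A) = diamondAt s A := by
  have := edge_eq (congrArg Subtype.val (toEdge_rep (toEdge A))).symm
  rw [diamond]
  rcases this with (e | e) | (e | e) <;> rw [e] <;> simp only [diamondAt_neg, diamondAt_mul_S]

end DiamondShear

end

namespace DiamondShear

/-! ### Chord lengths of Farey edges -/

/-! For `h` with Hölder derivative, the diamond shear has a closed form: on an edge `(a, c)` it is
`½ log (h'(a) h'(c) |a - c|² / |h(a) - h(c)|²)` (`diamond_shearCoord`). Shears telescope along a fan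
because adjacent fan chords satisfy a product identity (`dist_fanVertex_succ`), and the limits at
both ends of the fan produce `log h'`.

Sufficiency: the mean value theorem gives `log (|h(a) - h(c)| / |a - c|) = log h'(a) + O(|a - c| ^
α)` (`exists_abs_logQuot_sub_le`), so the squared diamond shear is `O(ℓ ^ (2α))`, where `ℓ` is the
chord length of the edge. The sum of `ℓ ^ s` over all Farey edges is finite for `s > 1`
(`summable_edgeLength_rpow`), hence `α > 1/2` is enough.

Necessity: a single map, `twist`, lies in the Hölder class for every `α ≤ 1/2`. Its derivative has a
one-sided square root singularity at `1`. At distance `r²` from `1`, the logarithm of the derivative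
and that of the difference quotient differ by a multiple of `r` to leading order, so the diamond
shears on the fan at `1` are at least a constant times `n ^ (-1/2)` (`le_diamond_twist_fan`), and
their squares dominate the harmonic series. -/

lemma mul_T_zpow_mul_S_zero (A : SL(2, ℤ)) (n : ℤ) :
    (A * ModularGroup.T ^ n * ModularGroup.S) 0 0 = A 0 1 + n * A 0 0 := by
  simp [Matrix.SpecialLinearGroup.coe_mul, ModularGroup.coe_S, ModularGroup.coe_T_zpow,
    Matrix.mul_apply, Fin.sum_univ_two]
  ring

lemma mul_T_zpow_mul_S_one (A : SL(2, ℤ)) (n : ℤ) :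
    (A * ModularGroup.T ^ n * ModularGroup.S) 1 0 = A 1 1 + n * A 1 0 := by
  simp [Matrix.SpecialLinearGroup.coe_mul, ModularGroup.coe_S, ModularGroup.coe_T_zpow,
    Matrix.mul_apply, Fin.sum_univ_two]
  ring

lemma vertex_mul_T_zpow (A : SL(2, ℤ)) (n : ℤ) : vertex (A * ModularGroup.T ^ n) = vertex A := by
  rw [vertex_eq_iff]
  simp [Matrix.SpecialLinearGroup.coe_mul, ModularGroup.coe_T_zpow,
    Matrix.mul_apply, Fin.sum_univ_two]

lemma det_eq (A : SL(2, ℤ)) : A 0 0 * A 1 1 - A 0 1 * A 1 0 = 1 := by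
  have hA := A.det_coe
  rwa [Matrix.det_fin_two] at hA

/-- The Euclidean norm of the first column of `A`. -/
noncomputable def columnNorm (A : SL(2, ℤ)) : ℝ := ‖((A 0 0 : ℂ) + (A 1 0 : ℂ) * Complex.I)‖

lemma columnNorm_pos (A : SL(2, ℤ)) : 0 < columnNorm A := norm_pos_iff.2 (column_ne_zero A)

lemma columnNorm_sq (A : SL(2, ℤ)) :
    columnNorm A ^ 2 = ((A 0 0 ^ 2 + A 1 0 ^ 2 : ℤ) : ℝ) := by
  rw [columnNorm, Complex.sq_norm, Complex.normSq_apply]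
  simp
  ring

lemma dist_vertex (A B : SL(2, ℤ)) : dist (vertex A) (vertex B) =
    2 * |((A 0 0 * B 1 0 - B 0 0 * A 1 0 : ℤ) : ℝ)| / (columnNorm A * columnNorm B) := by
  have hA := column_ne_zero A
  have hB := column_ne_zero B
  change dist (vertex A : ℂ) (vertex B : ℂ) = _
  rw [dist_eq_norm]
  change ‖(starRingEnd ℂ) _ / _ - (starRingEnd ℂ) _ / _‖ = _
  rw [div_sub_div _ _ hA hB, norm_div, norm_mul, columnNorm, columnNorm]
  congr 1
  have : (starRingEnd ℂ) ((A 0 0 : ℂ) + (A 1 0 : ℂ) * Complex.I)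
        * ((B 0 0 : ℂ) + (B 1 0 : ℂ) * Complex.I)
      - ((A 0 0 : ℂ) + (A 1 0 : ℂ) * Complex.I)
        * (starRingEnd ℂ) ((B 0 0 : ℂ) + (B 1 0 : ℂ) * Complex.I)
      = ((2 * (A 0 0 * B 1 0 - B 0 0 * A 1 0 : ℤ) : ℝ) : ℂ) * Complex.I := by
    apply Complex.ext <;> simp; ring
  rw [this, norm_mul, Complex.norm_I, mul_one, Complex.norm_real, Real.norm_eq_abs, abs_mul,
    abs_two]

lemma dist_vertex_mul_S (A : SL(2, ℤ)) : dist (vertex A) (vertex (A * ModularGroup.S)) =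
    2 / (columnNorm A * columnNorm (A * ModularGroup.S)) := by
  have h : A 0 0 * A 1 1 - A 0 1 * A 1 0 = 1 := det_eq A
  rw [dist_vertex, mul_S_zero, mul_S_one, h]
  simp

lemma vertex_ne_vertex_mul_S (A : SL(2, ℤ)) : vertex A ≠ vertex (A * ModularGroup.S) := by
  rw [← dist_pos, dist_vertex_mul_S]
  have := columnNorm_pos A
  have := columnNorm_pos (A * ModularGroup.S)
  positivity

/-- The chord length of a Farey edge. -/
noncomputable def edgeLength (e : fareyEdges) : ℝ :=
  dist (vertex (rep e)) (vertex (rep e * ModularGroup.S))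

lemma edgeLength_toEdge (A : SL(2, ℤ)) :
    edgeLength (toEdge A) = dist (vertex A) (vertex (A * ModularGroup.S)) := by
  have := congrArg Subtype.val (toEdge_rep (toEdge A))
  rcases Sym2.eq_iff.1 this with ⟨h1, h2⟩ | ⟨h1, h2⟩
  · rw [edgeLength, h1, h2]
  · rw [edgeLength, h1, h2, dist_comm]

lemma toEdge_mul_S (A : SL(2, ℤ)) : toEdge (A * ModularGroup.S) = toEdge A := by
  apply Subtype.ext
  simp only [toEdge, edge, mul_S_mul_S, vertex_neg]
  exact Sym2.eq_swap

/-- Every edge is represented by a matrix whose second column is the shorter one. -/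
lemma exists_rep_columns_le (e : fareyEdges) : ∃ A : SL(2, ℤ), toEdge A = e ∧
    A 0 1 ^ 2 + A 1 1 ^ 2 ≤ A 0 0 ^ 2 + A 1 0 ^ 2 := by
  rcases le_total (rep e 0 1 ^ 2 + rep e 1 1 ^ 2) (rep e 0 0 ^ 2 + rep e 1 0 ^ 2) with h | h
  · exact ⟨rep e, toEdge_rep e, h⟩
  · refine ⟨rep e * ModularGroup.S, by rw [toEdge_mul_S, toEdge_rep], ?_⟩
    simp only [Matrix.SpecialLinearGroup.coe_mul, ModularGroup.coe_S, Matrix.mul_apply,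
      Fin.sum_univ_two]
    simpa using h

/-- The second column of a matrix together with the integral part of the projection of the first
column to the second. -/
def columnCode (A : SL(2, ℤ)) : (Fin 2 → ℤ) × ℤ :=
  (![A 0 1, A 1 1], (A 0 0 * A 0 1 + A 1 0 * A 1 1) / (A 0 1 ^ 2 + A 1 1 ^ 2))

lemma secondColumn_sq_pos (A : SL(2, ℤ)) : 0 < A 0 1 ^ 2 + A 1 1 ^ 2 := by
  have h := det_eq A
  by_contra! h0
  have h1 : A 0 1 = 0 := by nlinarith [sq_nonneg (A 0 1), sq_nonneg (A 1 1)]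
  have h2 : A 1 1 = 0 := by nlinarith [sq_nonneg (A 0 1), sq_nonneg (A 1 1)]
  rw [h1, h2] at h
  simp at h

/-- Given the second column `v`, determinant one fixes the first column up to adding `k v`, and this
shifts the integral part of the projection by exactly `k`. -/
lemma columnCode_injective : Function.Injective columnCode := by
  intro A B hAB
  simp only [columnCode, Prod.mk.injEq] at hAB
  obtain ⟨hv, hn⟩ := hAB
  have h0 : A 0 1 = B 0 1 := congrFun hv 0
  have h1 : A 1 1 = B 1 1 := congrFun hv 1
  have hA := det_eq A
  have hB := det_eq B
  have hpos := secondColumn_sq_pos A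
  rw [← h0, ← h1] at hB hn
  -- If the first columns differ by `k v`, then `k` is the determinant of the first column of `A`
  -- with that difference.
  set k := A 0 0 * (A 1 0 - B 1 0) - A 1 0 * (A 0 0 - B 0 0) with hk
  have hx : A 0 0 = B 0 0 + k * A 0 1 := by
    linear_combination (-(A 0 0 - B 0 0)) * hA + A 0 0 * (hA - hB)
  have hy : A 1 0 = B 1 0 + k * A 1 1 := by
    linear_combination (-(A 1 0 - B 1 0)) * hA + A 1 0 * (hA - hB)
  have hdot : A 0 0 * A 0 1 + A 1 0 * A 1 1
      = B 0 0 * A 0 1 + B 1 0 * A 1 1 + k * (A 0 1 ^ 2 + A 1 1 ^ 2) := by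
    linear_combination A 0 1 * hx + A 1 1 * hy
  rw [hdot, Int.add_mul_ediv_right _ _ hpos.ne'] at hn
  have hk0 : k = 0 := by linarith
  rw [hk0] at hx hy
  ext i j
  fin_cases i <;> fin_cases j <;> simp_all

lemma columnNorm_mul_S_sq (A : SL(2, ℤ)) :
    columnNorm (A * ModularGroup.S) ^ 2 = ((A 0 1 ^ 2 + A 1 1 ^ 2 : ℤ) : ℝ) := by
  rw [columnNorm_sq, mul_S_zero, mul_S_one]

/-- With columns `u`, `v` the chord is `2 / (|u| |v|)`. If `|v| ≤ |u|` and `n` is the coded integer,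
then `(|n| - 1) |v|² ≤ |u · v| ≤ |u| |v|`, so `(|n| + 1) |v|² ≤ 3 |u| |v|`; this is the source of
the `6`. -/
lemma dist_vertex_le_columnCode (A : SL(2, ℤ))
    (hA : A 0 1 ^ 2 + A 1 1 ^ 2 ≤ A 0 0 ^ 2 + A 1 0 ^ 2) :
    dist (vertex A) (vertex (A * ModularGroup.S)) ≤
      6 * (‖(columnCode A).1‖ ^ 2 * (1 + |((columnCode A).2 : ℝ)|))⁻¹ := by
  rw [dist_vertex_mul_S]
  have hu := columnNorm_pos A
  have hv := columnNorm_pos (A * ModularGroup.S)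
  have hu2 := columnNorm_sq A
  have hv2 := columnNorm_mul_S_sq A
  set u := columnNorm A
  set v := columnNorm (A * ModularGroup.S)
  have hpos := secondColumn_sq_pos A
  set Q : ℤ := A 0 1 ^ 2 + A 1 1 ^ 2 with hQ
  set m : ℤ := A 0 0 * A 0 1 + A 1 0 * A 1 1 with hm
  have hsup0 : 0 < ‖(columnCode A).1‖ := by
    rw [norm_pos_iff]
    intro h
    have h0 : A 0 1 = 0 := congrFun h 0
    have h1 : A 1 1 = 0 := congrFun h 1
    rw [hQ, h0, h1] at hpos
    simp at hpos
  have hsup : ‖(columnCode A).1‖ ≤ v := by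
    rw [pi_norm_le_iff_of_nonneg hv.le]
    intro i
    rw [Int.norm_eq_abs]
    apply abs_le_of_sq_le_sq _ hv.le
    rw [hv2, hQ]
    push_cast
    fin_cases i
    · change (A 0 1 : ℝ) ^ 2 ≤ _
      linarith [sq_nonneg (A 1 1 : ℝ)]
    · change (A 1 1 : ℝ) ^ 2 ≤ _
      linarith [sq_nonneg (A 0 1 : ℝ)]
  have huv : v ≤ u := by
    apply le_of_sq_le_sq _ hu.le
    rw [hu2, hv2]
    exact_mod_cast hA
  have hdot : |(m : ℝ)| ≤ u * v := by
    apply abs_le_of_sq_le_sq _ (by positivity)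
    rw [mul_pow, hu2, hv2]
    have hd := det_eq A
    have : m ^ 2 ≤ (A 0 0 ^ 2 + A 1 0 ^ 2) * Q := by
      have : (A 0 0 ^ 2 + A 1 0 ^ 2) * Q
          = m ^ 2 + (A 0 0 * A 1 1 - A 0 1 * A 1 0) ^ 2 := by rw [hQ, hm]; ring
      rw [this, hd]; linarith
    exact_mod_cast this
  -- The `- 1` absorbs the rounding of the floor when the projection is negative.
  have hfloor : (|((columnCode A).2 : ℝ)| - 1) * v ^ 2 ≤ |(m : ℝ)| := by
    have h1 : (m / Q) * Q ≤ m := Int.ediv_mul_le _ hpos.ne'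
    have h2 : m < (m / Q + 1) * Q := Int.lt_ediv_add_one_mul_self _ hpos
    have h1' : (((m / Q : ℤ) : ℝ)) * Q ≤ m := by exact_mod_cast h1
    have h2' : (m : ℝ) < (((m / Q : ℤ) : ℝ) + 1) * Q := by exact_mod_cast h2
    have hQ' : (0 : ℝ) < Q := by exact_mod_cast hpos
    change (|((m / Q : ℤ) : ℝ)| - 1) * v ^ 2 ≤ _
    rw [hv2]
    rcases abs_cases ((m / Q : ℤ) : ℝ) with ⟨h, -⟩ | ⟨h, -⟩ <;> rw [h]
    · nlinarith [le_abs_self (m : ℝ)]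
    · nlinarith [neg_le_abs (m : ℝ)]
  set n : ℝ := |((columnCode A).2 : ℝ)|
  have hn : 0 ≤ n := abs_nonneg _
  rw [div_eq_mul_inv, show (6 : ℝ) = 2 * 3 by norm_num, mul_assoc]
  apply mul_le_mul_of_nonneg_left _ zero_le_two
  rw [← div_eq_mul_inv, inv_eq_one_div, div_le_div_iff₀ (by positivity) (by positivity)]
  have hs2 : ‖(columnCode A).1‖ ^ 2 ≤ v ^ 2 := by gcongr
  nlinarith [mul_le_mul_of_nonneg_right hs2 (by positivity : 0 ≤ 1 + n),
    mul_le_mul_of_nonneg_right huv hv.le]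

lemma summable_int_one_add_abs_rpow {s : ℝ} (hs : 1 < s) :
    Summable fun n : ℤ => (1 + |(n : ℝ)|) ^ (-s) := by
  have h : Summable fun n : ℕ => (1 + (n : ℝ)) ^ (-s) := by
    have := (summable_nat_add_iff 1).2 (Real.summable_nat_rpow.2 (neg_lt_neg hs))
    refine this.congr fun n => ?_
    push_cast
    rw [add_comm]
  refine Summable.of_nat_of_neg ?_ ?_
  · simpa using h
  · simpa using h

/-- The `s`-th powers of the lengths of the Farey edges are summable for `s > 1`. -/
theorem summable_edgeLength_rpow {s : ℝ} (hs : 1 < s) :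
    Summable fun e : fareyEdges => edgeLength e ^ s := by
  choose R hR hRle using exists_rep_columns_le
  have hinj : Function.Injective fun e => columnCode (R e) := fun e f h => by
    rw [← hR e, ← hR f, columnCode_injective h]
  -- The lattice sum over `v` has exponent `2s > 2`, the sum over the integer has exponent `s > 1`.
  have hprod := (EisensteinSeries.summable_one_div_norm_rpow
    (by linarith : (2 : ℝ) < 2 * s)).mul_of_nonneg
    (summable_int_one_add_abs_rpow hs) (fun v => by positivity) (fun n => by positivity)
  have hsum := (hprod.comp_injective hinj).mul_left ((6 : ℝ) ^ s)
  refine hsum.of_nonneg_of_le (fun e => Real.rpow_nonneg dist_nonneg _) fun e => ?_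
  have hle := dist_vertex_le_columnCode (R e) (hRle e)
  rw [← edgeLength_toEdge, hR] at hle
  refine (Real.rpow_le_rpow dist_nonneg hle (by linarith)).trans_eq ?_
  simp only [Function.comp]
  rw [Real.mul_rpow (by norm_num) (by positivity), Real.inv_rpow (by positivity),
    Real.mul_rpow (by positivity) (by positivity), mul_inv, ← Real.rpow_natCast,
    ← Real.rpow_mul (by positivity), Real.rpow_neg (by positivity), Real.rpow_neg (by positivity)]
  norm_num

lemma tendsto_edgeLength_cofinite : Tendsto edgeLength cofinite (𝓝 0) := by
  have h := (summable_edgeLength_rpow one_lt_two).tendsto_cofinite_zero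
  have h' := h.sqrt
  rw [Real.sqrt_zero] at h'
  refine h'.congr fun e => ?_
  rw [Real.rpow_two, Real.sqrt_sq (by exact dist_nonneg)]

/-! ### Fans -/

/-- The vertex `A(n)` of the fan at `A(∞)`. -/
noncomputable def fanVertex (A : SL(2, ℤ)) (n : ℤ) : Circle := vertex (A * ModularGroup.T ^ n * ModularGroup.S)

lemma fan_injective (A : SL(2, ℤ)) : Function.Injective (fan A) := by
  intro m n h
  have h' := congrArg Subtype.val h
  have hm : vertex A ≠ fanVertex A m := by
    have := vertex_ne_vertex_mul_S (A * ModularGroup.T ^ m)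
    rwa [vertex_mul_T_zpow] at this
  simp only [fan, toEdge, edge, vertex_mul_T_zpow] at h'
  rcases Sym2.eq_iff.1 h' with ⟨-, h2⟩ | ⟨-, h2⟩
  · rw [vertex_eq_iff] at h2
    simp only [mul_T_zpow_mul_S_zero, mul_T_zpow_mul_S_one] at h2
    have := det_eq A
    have h3 : (m - n) * (A 0 0 * A 1 1 - A 0 1 * A 1 0) = 0 := by linear_combination h2
    rw [this, mul_one] at h3
    linarith
  · exact absurd h2.symm hm

lemma dist_vertex_fanVertex (A : SL(2, ℤ)) (n : ℤ) :
    dist (vertex A) (fanVertex A n) = edgeLength (fan A n) := by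
  rw [fan, edgeLength_toEdge, vertex_mul_T_zpow, fanVertex]

lemma tendsto_fanVertex (A : SL(2, ℤ)) : Tendsto (fanVertex A) cofinite (𝓝 (vertex A)) := by
  rw [tendsto_iff_dist_tendsto_zero]
  refine (tendsto_edgeLength_cofinite.comp (fan_injective A).tendsto_cofinite).congr fun n => ?_
  rw [dist_comm, dist_vertex_fanVertex]
  rfl

/-- All three chords join Farey neighbours, so their lengths are `2` over products of column norms.
The factor does not depend on `n`, so the lengths of the unmapped chords drop out of the shears
along the fan. -/
lemma dist_fanVertex_succ (A : SL(2, ℤ)) (n : ℤ) :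
    dist (fanVertex A n) (fanVertex A (n + 1)) =
      columnNorm A ^ 2 / 2 *
        (dist (fanVertex A n) (vertex A) * dist (fanVertex A (n + 1)) (vertex A)) := by
  have hA := det_eq A
  have h0 := columnNorm_pos A
  have h1 := columnNorm_pos (A * ModularGroup.T ^ n * ModularGroup.S)
  have h2 := columnNorm_pos (A * ModularGroup.T ^ (n + 1) * ModularGroup.S)
  simp only [fanVertex, dist_vertex]
  simp only [mul_T_zpow_mul_S_zero, mul_T_zpow_mul_S_one]
  have e1 : (A 0 1 + n * A 0 0) * (A 1 1 + (n + 1) * A 1 0)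
      - (A 0 1 + (n + 1) * A 0 0) * (A 1 1 + n * A 1 0) = -1 := by linear_combination -hA
  have e2 : ∀ k : ℤ, (A 0 1 + k * A 0 0) * A 1 0 - A 0 0 * (A 1 1 + k * A 1 0) = -1 :=
    fun k => by linear_combination -hA
  rw [e1, e2, e2]
  simp only [Int.cast_neg, Int.cast_one, abs_neg, abs_one]
  field_simp

/-! ### Difference quotients of differentiable circle homeomorphisms -/

/-- The logarithm of the chordal difference quotient of `h`. -/
noncomputable def logQuot (h : Circle ≃ₜ Circle) (x y : Circle) : ℝ :=
  Real.log (dist (h x) (h y) / dist x y)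

lemma logQuot_comm (h : Circle ≃ₜ Circle) (x y : Circle) : logQuot h x y = logQuot h y x := by
  rw [logQuot, logQuot, dist_comm x, dist_comm (h x)]

lemma dist_mul_exp_self (x : Circle) (t : ℝ) :
    dist (x * Circle.exp t) x = ‖2 * Real.sin (t / 2)‖ := by
  rw [← Complex.norm_exp_I_mul_ofReal_sub_one]
  change dist ((x : ℂ) * (Circle.exp t : ℂ)) (x : ℂ) = _
  rw [dist_eq_norm, Circle.coe_exp, mul_comm (t : ℂ)]
  conv_lhs => rw [show (x : ℂ) * Complex.exp (Complex.I * t) - x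
    = x * (Complex.exp (Complex.I * t) - 1) by ring]
  rw [norm_mul, Circle.norm_coe, one_mul]

lemma dist_mul_exp_self_le (x : Circle) (t : ℝ) : dist (x * Circle.exp t) x ≤ |t| := by
  rw [dist_mul_exp_self, ← Complex.norm_exp_I_mul_ofReal_sub_one]
  exact Real.norm_exp_I_mul_ofReal_sub_one_le

lemma mul_exp_arg_div (x y : Circle) : x * Circle.exp (Complex.arg (y / x : Circle)) = y := by
  rw [Circle.exp_arg, mul_div_cancel]

/-- Jordan's inequality `sin u ≥ 2u / π`, with `π / 2` rounded up to `2`. -/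
lemma abs_arg_div_le (x y : Circle) : |Complex.arg (y / x : Circle)| ≤ 2 * dist x y := by
  set t := Complex.arg (y / x : Circle) with ht
  have h1 : |t / 2| ≤ Real.pi / 2 := by
    rw [abs_div, abs_two]
    linarith [Complex.abs_arg_le_pi (y / x : Circle)]
  have h2 := Real.mul_abs_le_abs_sin h1
  have h3 : dist x y = 2 * |Real.sin (t / 2)| := by
    rw [dist_comm, ← mul_exp_arg_div x y, dist_mul_exp_self, Real.norm_eq_abs, abs_mul, abs_two]
  rw [abs_div, abs_two] at h2
  rw [h3]
  have h4 : 1 / 2 * |t| ≤ 2 / Real.pi * |t| := by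
    apply mul_le_mul_of_nonneg_right _ (abs_nonneg t)
    rw [div_le_div_iff₀ two_pos Real.pi_pos]
    linarith [Real.pi_lt_four]
  linarith [show 2 / Real.pi * (|t| / 2) = 2 / Real.pi * |t| / 2 by ring]

/-- Passing from chords to arcs costs a linear error, which is harmless next to `|t| ^ α` because `α
≤ 1`. -/
lemma abs_log_chord_sub_log_le {t : ℝ} (h0 : t ≠ 0) (h1 : |t| ≤ 1) :
    |Real.log ‖2 * Real.sin (t / 2)‖ - Real.log (|t|)| ≤ |t| := by
  have ht : 0 < |t| := abs_pos.2 h0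
  have hn : ‖2 * Real.sin (t / 2)‖ = 2 * Real.sin (|t| / 2) := by
    rw [Real.norm_eq_abs, abs_mul, abs_two]
    congr 1
    rcases abs_cases t with ⟨h, -⟩ | ⟨h, -⟩
    · rw [h, abs_of_nonneg]
      exact Real.sin_nonneg_of_nonneg_of_le_pi (by linarith) (by linarith [Real.pi_gt_three])
    · rw [h, neg_div, Real.sin_neg, abs_of_nonpos]
      exact Real.sin_nonpos_of_nonpos_of_neg_pi_le (by linarith) (by linarith [Real.pi_gt_three])
  rw [hn]
  set u := |t|
  have hup : Real.sin (u / 2) ≤ u / 2 := Real.sin_le (by positivity)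
  have hlow : u / 2 - (u / 2) ^ 3 / 6 ≤ Real.sin (u / 2) := Real.sin_ge_sub_cube (by positivity)
  have hlow' : u * (1 - u / 24) ≤ 2 * Real.sin (u / 2) := by nlinarith [mul_pos ht ht]
  have hpos : 0 < 1 - u / 24 := by linarith
  have hs : 0 < 2 * Real.sin (u / 2) := lt_of_lt_of_le (by positivity) hlow'
  rw [abs_le]
  constructor
  · have h2 : Real.log (u * (1 - u / 24)) ≤ Real.log (2 * Real.sin (u / 2)) :=
      Real.log_le_log (by positivity) hlow'
    rw [Real.log_mul ht.ne' hpos.ne'] at h2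
    have h3 := Real.one_sub_inv_le_log_of_pos hpos
    have h4 : (1 - u / 24)⁻¹ ≤ 1 + u := by
      rw [inv_le_iff_one_le_mul₀ hpos]
      nlinarith
    linarith
  · have h2 : Real.log (2 * Real.sin (u / 2)) ≤ Real.log u := Real.log_le_log hs (by linarith)
    linarith

lemma hasDerivAt_comp_mul_exp {h : Circle ≃ₜ Circle}
    (hd : ∀ z : Circle, DifferentiableAt ℝ (fun t : ℝ => (h (z * Circle.exp t) : ℂ)) 0)
    (x : Circle) (τ : ℝ) : ∃ d : ℂ, ‖d‖ = circleDeriv h (x * Circle.exp τ) ∧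
      HasDerivAt (fun t : ℝ => (h (x * Circle.exp t) : ℂ)) d τ := by
  refine ⟨_, rfl, ?_⟩
  have h1 := (hd (x * Circle.exp τ)).hasDerivAt
  have h2 := HasDerivAt.comp_sub_const (x := τ) (a := τ)
    (f := fun t : ℝ => (h (x * Circle.exp τ * Circle.exp t) : ℂ)) (by rw [sub_self]; exact h1)
  refine h2.congr_of_eventuallyEq (Eventually.of_forall fun t => ?_)
  simp only
  rw [mul_assoc, ← Circle.exp_add, add_sub_cancel]

/-- Mean value theorem for the angular displacement of a circle homeomorphism. -/
lemma exists_abs_arg_eq {h : Circle ≃ₜ Circle}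
    (hd : ∀ z : Circle, DifferentiableAt ℝ (fun t : ℝ => (h (z * Circle.exp t) : ℂ)) 0)
    (x : Circle) (t : ℝ)
    (hclose : ∀ τ : ℝ, |τ| ≤ |t| → dist (h (x * Circle.exp τ)) (h x) < 1) :
    ∃ ξ : ℝ, |ξ| ≤ |t| ∧ |Complex.arg (h (x * Circle.exp t) / h x : Circle)|
      = circleDeriv h (x * Circle.exp ξ) * |t| := by
  set g : ℝ → ℂ := fun τ => (h (x * Circle.exp τ) : ℂ) / h x with hg
  have hgnorm : ∀ τ, ‖g τ‖ = 1 := fun τ => by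
    rw [hg, norm_div, Circle.norm_coe, Circle.norm_coe, div_one]
  have hslit : ∀ τ : ℝ, |τ| ≤ |t| → g τ ∈ Complex.slitPlane := by
    intro τ hτ
    have h1 : ‖g τ - 1‖ < 1 := by
      have h2 : g τ - 1 = ((h (x * Circle.exp τ) : ℂ) - h x) / h x := by
        rw [sub_div, div_self (Circle.coe_ne_zero _)]
      rw [h2, norm_div, Circle.norm_coe, div_one, ← dist_eq_norm]
      exact hclose τ hτ
    have := Complex.mem_slitPlane_of_norm_lt_one h1
    rwa [add_sub_cancel] at this
  have key : ∀ τ : ℝ, |τ| ≤ |t| → ∃ d : ℝ, |d| = circleDeriv h (x * Circle.exp τ) ∧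
      HasDerivAt (fun τ => (g τ).arg) d τ := by
    intro τ hτ
    obtain ⟨d, hdn, hdd⟩ := hasDerivAt_comp_mul_exp hd x τ
    have hgd : HasDerivAt g (d / h x) τ := hdd.div_const _
    have hlog := hgd.clog_real (hslit τ hτ)
    have hre := Complex.reCLM.hasFDerivAt.comp_hasDerivAt τ hlog
    have him := Complex.imCLM.hasFDerivAt.comp_hasDerivAt τ hlog
    set w := d / h x / g τ with hw
    -- The real part of `log g` is constantly zero as `|g| = 1`, so the whole derivative of `log g`
    -- is carried by the argument.
    have hre0 : w.re = 0 := by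
      refine hre.unique ((hasDerivAt_const τ (0 : ℝ)).congr_of_eventuallyEq
        (Eventually.of_forall fun σ => ?_))
      simp [Complex.log_re, hgnorm]
    refine ⟨w.im, ?_, ?_⟩
    · rw [← hdn]
      have : ‖w‖ = ‖d‖ := by rw [hw, norm_div, norm_div, hgnorm, Circle.norm_coe]; simp
      rw [← this, ← Complex.re_add_im w, hre0]
      simp
    · refine him.congr_of_eventuallyEq (Eventually.of_forall fun σ => ?_)
      simp [Complex.log_im]
  choose! d hdn hdd using key
  have hbound : ∀ σ ∈ Set.Icc (0 : ℝ) 1, |σ * t| ≤ |t| := by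
    intro σ hσ
    rw [abs_mul, abs_of_nonneg hσ.1]
    exact mul_le_of_le_one_left (abs_nonneg t) hσ.2
  have hF : ∀ σ ∈ Set.Icc (0 : ℝ) 1,
      HasDerivAt (fun σ => (g (σ * t)).arg) (d (σ * t) * t) σ := fun σ hσ => by
    have h1 : HasDerivAt (fun σ : ℝ => σ * t) t σ := by
      simpa using (hasDerivAt_id σ).mul_const t
    exact HasDerivAt.comp σ (hdd _ (hbound σ hσ)) h1
  obtain ⟨c, hc, hceq⟩ := exists_hasDerivAt_eq_slope (fun σ => (g (σ * t)).arg)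
    (fun σ => d (σ * t) * t) one_pos (fun σ hσ => (hF σ hσ).continuousAt.continuousWithinAt)
    (fun σ hσ => hF σ (Set.Ioo_subset_Icc_self hσ))
  have hc' := hbound c (Set.Ioo_subset_Icc_self hc)
  refine ⟨c * t, hc', ?_⟩
  rw [← hdn _ hc', ← abs_mul, hceq]
  simp [hg]

lemma abs_log_circleDeriv_sub_le {h : Circle ≃ₜ Circle} {C α : ℝ≥0}
    (hC : HolderWith C α (fun z : Circle => Real.log (circleDeriv h z))) (x y : Circle) :
    |Real.log (circleDeriv h x) - Real.log (circleDeriv h y)| ≤ C * dist x y ^ (α : ℝ) :=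
  hC.dist_le x y

lemma exists_circleDeriv_le {h : Circle ≃ₜ Circle} {C α : ℝ≥0} (hα : 0 < α)
    (h0 : ∀ z : Circle, circleDeriv h z ≠ 0)
    (hC : HolderWith C α (fun z : Circle => Real.log (circleDeriv h z))) :
    ∃ M : ℝ, 0 < M ∧ ∀ z, circleDeriv h z ≤ M := by
  obtain ⟨B, hB⟩ := (isCompact_range (hC.continuous hα)).bddAbove
  refine ⟨Real.exp B, Real.exp_pos _, fun z => ?_⟩
  have hpos : 0 < circleDeriv h z := lt_of_le_of_ne (norm_nonneg _) (h0 z).symm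
  rw [← Real.log_le_iff_le_exp hpos]
  exact hB ⟨z, rfl⟩

/-- The difference quotients of a circle homeomorphism with Hölder derivative approximate its
derivative. -/
theorem exists_abs_logQuot_sub_le {α : ℝ≥0} (hα : 0 < α) (hα' : α ≤ 1) {h : Circle ≃ₜ Circle}
    (hh : h ∈ holderClass α) : ∃ C δ : ℝ, 0 < C ∧ 0 < δ ∧ ∀ x y : Circle, x ≠ y → dist x y < δ →
      |logQuot h x y - Real.log (circleDeriv h x)| ≤ C * dist x y ^ (α : ℝ) := by
  obtain ⟨-, hd, h0, K, hK⟩ := hh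
  obtain ⟨M, hM, hMle⟩ := exists_circleDeriv_le hα h0 hK
  obtain ⟨δ₀, hδ₀, hδ₀'⟩ := Metric.uniformContinuous_iff.1
    (CompactSpace.uniformContinuous_of_continuous h.continuous) 1 one_pos
  -- The three radii keep the image of the arc within distance `1` of `h x`, the angle `t` at most
  -- `1`, and the image angle `θ` at most `1`. In the constant, `M` and `1` come from the arc-chord
  -- errors of `θ` and `t`, `K` from the Hölder condition, and `2` from `|t| ≤ 2 dist x y`.
  refine ⟨2 * (M + 1 + K), min (δ₀ / 2) (min (1 / 2) (1 / (2 * M))), by positivity, by positivity,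
    fun x y hxy hdist => ?_⟩
  simp only [lt_min_iff] at hdist
  obtain ⟨hd1, hd2, hd3⟩ := hdist
  set t := Complex.arg (y / x : Circle) with ht
  have hy : x * Circle.exp t = y := mul_exp_arg_div x y
  have htle : |t| ≤ 2 * dist x y := abs_arg_div_le x y
  have ht0 : t ≠ 0 := by
    intro h
    rw [h, Circle.exp_zero, mul_one] at hy
    exact hxy hy
  have ht1 : |t| ≤ 1 := by linarith
  have htpos : 0 < |t| := abs_pos.2 ht0
  have htM : M * |t| ≤ 1 := by
    rw [lt_div_iff₀ (by positivity)] at hd3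
    nlinarith
  obtain ⟨ξ, hξ, hξeq⟩ := exists_abs_arg_eq hd x t fun τ hτ => hδ₀' (by
    linarith [dist_mul_exp_self_le x τ])
  rw [hy] at hξeq
  set θ := Complex.arg (h y / h x : Circle) with hθ
  have hhy : h x * Circle.exp θ = h y := mul_exp_arg_div _ _
  have hdpos : 0 < circleDeriv h (x * Circle.exp ξ) :=
    lt_of_le_of_ne (norm_nonneg _) (h0 _).symm
  have hθle : |θ| ≤ M * |t| := by
    rw [hξeq]
    exact mul_le_mul_of_nonneg_right (hMle _) htpos.le
  have hθ0 : θ ≠ 0 := by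
    rw [← abs_pos, hξeq]
    positivity
  have e1 := abs_log_chord_sub_log_le ht0 ht1
  have e2 := abs_log_chord_sub_log_le hθ0 (hθle.trans htM)
  rw [← dist_mul_exp_self x, hy, dist_comm] at e1
  rw [← dist_mul_exp_self (h x), hhy, dist_comm] at e2
  have e3 : Real.log |θ| = Real.log (circleDeriv h (x * Circle.exp ξ)) + Real.log |t| := by
    rw [hξeq, Real.log_mul hdpos.ne' htpos.ne']
  have e4 := abs_log_circleDeriv_sub_le hK (x * Circle.exp ξ) x
  have e5 : dist (x * Circle.exp ξ) x ^ (α : ℝ) ≤ |t| ^ (α : ℝ) :=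
    Real.rpow_le_rpow dist_nonneg ((dist_mul_exp_self_le x ξ).trans hξ) α.2
  have e6 : |t| ≤ |t| ^ (α : ℝ) := by
    conv_lhs => rw [← Real.rpow_one |t|]
    exact Real.rpow_le_rpow_of_exponent_ge htpos ht1 (by exact_mod_cast hα')
  have e7 : |t| ^ (α : ℝ) ≤ 2 * dist x y ^ (α : ℝ) := by
    refine (Real.rpow_le_rpow htpos.le htle α.2).trans ?_
    rw [Real.mul_rpow zero_le_two dist_nonneg]
    refine mul_le_mul_of_nonneg_right ?_ (Real.rpow_nonneg dist_nonneg _)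
    conv_rhs => rw [← Real.rpow_one 2]
    exact Real.rpow_le_rpow_of_exponent_le one_le_two (by exact_mod_cast hα')
  have e8 : |logQuot h x y - Real.log (circleDeriv h x)| ≤ |θ| + |t| + K * |t| ^ (α : ℝ) := by
    have hdh : dist (h x) (h y) ≠ 0 := dist_ne_zero.2 (h.injective.ne hxy)
    rw [logQuot, Real.log_div hdh (dist_ne_zero.2 hxy)]
    have e4' := e4.trans (mul_le_mul_of_nonneg_left e5 K.2)
    rw [abs_le] at e1 e2 e4' ⊢
    constructor <;> linarith [e1.1, e1.2, e2.1, e2.2, e4'.1, e4'.2]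
  calc _ ≤ |θ| + |t| + K * |t| ^ (α : ℝ) := e8
    _ ≤ (M + 1 + K) * |t| ^ (α : ℝ) := by nlinarith [mul_le_mul_of_nonneg_left e6 hM.le]
    _ ≤ (M + 1 + K) * (2 * dist x y ^ (α : ℝ)) := by gcongr
    _ = _ := by ring

/-! ### Diamond shears of differentiable circle homeomorphisms -/

lemma fanVertex_ne_vertex (A : SL(2, ℤ)) (n : ℤ) : fanVertex A n ≠ vertex A := by
  have := vertex_ne_vertex_mul_S (A * ModularGroup.T ^ n)
  rw [vertex_mul_T_zpow] at this
  exact this.symm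

lemma fanVertex_ne_succ (A : SL(2, ℤ)) (n : ℤ) : fanVertex A n ≠ fanVertex A (n + 1) := by
  rw [← dist_pos, dist_fanVertex_succ]
  have := columnNorm_pos A
  have h1 := dist_pos.2 (fanVertex_ne_vertex A n)
  have h2 := dist_pos.2 (fanVertex_ne_vertex A (n + 1))
  positivity

/-- A primitive of the shear coordinate along the fan at `A(∞)`. -/
noncomputable def fanLog (h : Circle ≃ₜ Circle) (A : SL(2, ℤ)) (n : ℤ) : ℝ :=
  logQuot h (fanVertex A n) (fanVertex A (n + 1)) - logQuot h (fanVertex A n) (vertex A)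
    - logQuot h (fanVertex A (n + 1)) (vertex A)

lemma logQuot_eq (h : Circle ≃ₜ Circle) {x y : Circle} (hxy : x ≠ y) :
    logQuot h x y = Real.log (dist (h x) (h y)) - Real.log (dist x y) :=
  Real.log_div (dist_ne_zero.2 (h.injective.ne hxy)) (dist_ne_zero.2 hxy)

lemma log_dist_fanVertex_succ (A : SL(2, ℤ)) (n : ℤ) :
    Real.log (dist (fanVertex A n) (fanVertex A (n + 1))) = Real.log (columnNorm A ^ 2 / 2)
      + Real.log (dist (fanVertex A n) (vertex A))
      + Real.log (dist (fanVertex A (n + 1)) (vertex A)) := by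
  have h0 := columnNorm_pos A
  have h1 := dist_ne_zero.2 (fanVertex_ne_vertex A n)
  have h2 := dist_ne_zero.2 (fanVertex_ne_vertex A (n + 1))
  rw [dist_fanVertex_succ, Real.log_mul (by positivity) (mul_ne_zero h1 h2), Real.log_mul h1 h2,
    add_assoc]

lemma shear_eq_log_dist {a b c d : Circle} (hab : b ≠ a) (hcd : c ≠ d) (hbc : b ≠ c)
    (had : d ≠ a) : shear a b c d = Real.log (dist b a) + Real.log (dist c d)
      - Real.log (dist b c) - Real.log (dist d a) := by
  have e : ∀ x y : Circle, ‖(x : ℂ) - y‖ = dist x y := fun x y => (dist_eq_norm (x : ℂ) y).symm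
  rw [shear, crossRatio, norm_div, norm_mul, norm_mul, e, e, e, e, dist_comm d c, dist_comm c b,
    Real.log_div (mul_ne_zero (dist_ne_zero.2 hab) (dist_ne_zero.2 hcd))
      (mul_ne_zero (dist_ne_zero.2 hbc) (dist_ne_zero.2 had)),
    Real.log_mul (dist_ne_zero.2 hab) (dist_ne_zero.2 hcd),
    Real.log_mul (dist_ne_zero.2 hbc) (dist_ne_zero.2 had)]
  ring

/-- By `log_dist_fanVertex_succ` the contributions of the unmapped chords cancel, so image distances
may be replaced by difference quotients. -/
lemma shearCoord_fan (h : Circle ≃ₜ Circle) (A : SL(2, ℤ)) (n : ℤ) :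
    shearCoord h (fan A (n + 1)) = fanLog h A (n + 1) - fanLog h A n := by
  have e1 : A * ModularGroup.T ^ (n + 1) * ModularGroup.T⁻¹ = A * ModularGroup.T ^ n := by
    rw [mul_assoc, ← zpow_neg_one, ← zpow_add, add_neg_cancel_right]
  have e2 : A * ModularGroup.T ^ (n + 1) * ModularGroup.T
      = A * ModularGroup.T ^ (n + 1 + 1) := by
    rw [mul_assoc, ← zpow_add_one]
  rw [fan, shearCoord_toEdge, shearAt, e1, e2, vertex_mul_T_zpow]
  change shear (h (vertex A)) (h (fanVertex A n)) (h (fanVertex A (n + 1)))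
    (h (fanVertex A (n + 1 + 1))) = _
  rw [shear_eq_log_dist (h.injective.ne (fanVertex_ne_vertex A n))
    (h.injective.ne (fanVertex_ne_succ A (n + 1))) (h.injective.ne (fanVertex_ne_succ A n))
    (h.injective.ne (fanVertex_ne_vertex A (n + 1 + 1))), fanLog, fanLog,
    logQuot_eq h (fanVertex_ne_succ A (n + 1)), logQuot_eq h (fanVertex_ne_succ A n),
    logQuot_eq h (fanVertex_ne_vertex A n), logQuot_eq h (fanVertex_ne_vertex A (n + 1)),
    logQuot_eq h (fanVertex_ne_vertex A (n + 1 + 1)), log_dist_fanVertex_succ,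
    log_dist_fanVertex_succ]
  ring

lemma tendsto_logQuot {α : ℝ≥0} (hα : 0 < α) (hα' : α ≤ 1) {h : Circle ≃ₜ Circle}
    (hh : h ∈ holderClass α) {ι : Type*} {l : Filter ι} {x y : ι → Circle} {a : Circle}
    (hx : Tendsto x l (𝓝 a)) (hy : Tendsto y l (𝓝 a)) (hxy : ∀ i, x i ≠ y i) :
    Tendsto (fun i => logQuot h (x i) (y i)) l (𝓝 (Real.log (circleDeriv h a))) := by
  obtain ⟨C, δ, hC, hδ, hle⟩ := exists_abs_logQuot_sub_le hα hα' hh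
  obtain ⟨-, -, -, K, hK⟩ := hh
  have hdist : Tendsto (fun i => dist (x i) (y i)) l (𝓝 0) := by
    simpa using hx.dist hy
  have hlog := (hK.continuous hα).continuousAt.tendsto.comp hx
  have hpow : Tendsto (fun i => C * dist (x i) (y i) ^ (α : ℝ)) l (𝓝 0) := by
    have := (hdist.rpow_const (p := (α : ℝ)) (Or.inr α.coe_nonneg)).const_mul C
    rwa [Real.zero_rpow (NNReal.coe_ne_zero.2 hα.ne'), mul_zero] at this
  have hdiff : Tendsto (fun i => logQuot h (x i) (y i) - Real.log (circleDeriv h (x i)))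
      l (𝓝 0) := by
    refine squeeze_zero_norm' ?_ hpow
    filter_upwards [hdist.eventually (gt_mem_nhds hδ)] with i hi
    exact hle _ _ (hxy i) hi
  simpa using hdiff.add hlog

/-- Each of the three quotients tends to `log h'` at the fan centre, with signs `+, -, -`. The
cofinite filter on `ℤ` treats both ends of the fan at once. -/
lemma tendsto_fanLog {α : ℝ≥0} (hα : 0 < α) (hα' : α ≤ 1) {h : Circle ≃ₜ Circle}
    (hh : h ∈ holderClass α) (A : SL(2, ℤ)) :
    Tendsto (fanLog h A) cofinite (𝓝 (-Real.log (circleDeriv h (vertex A)))) := by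
  have h0 := tendsto_fanVertex A
  have h1 : Tendsto (fun n => fanVertex A (n + 1)) cofinite (𝓝 (vertex A)) :=
    h0.comp (add_left_injective (1 : ℤ)).tendsto_cofinite
  have t1 := tendsto_logQuot hα hα' hh h0 h1 (fanVertex_ne_succ A)
  have t2 := tendsto_logQuot hα hα' hh h0 tendsto_const_nhds (fanVertex_ne_vertex A)
  have t3 := tendsto_logQuot hα hα' hh h1 tendsto_const_nhds
    (fun n => fanVertex_ne_vertex A (n + 1))
  have := (t1.sub t2).sub t3
  rwa [sub_self, zero_sub] at this

lemma tendsto_natCast_cofinite : Tendsto (fun n : ℕ => (n : ℤ)) atTop cofinite := by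
  rw [← Nat.cofinite_eq_atTop]
  exact Nat.cast_injective.tendsto_cofinite

lemma tendsto_neg_natCast_cofinite :
    Tendsto (fun n : ℕ => -((n : ℤ) + 1)) atTop cofinite := by
  rw [← Nat.cofinite_eq_atTop]
  exact Function.Injective.tendsto_cofinite fun m n hmn => by simpa using hmn

lemma sum_shearCoord_fan_pos (h : Circle ≃ₜ Circle) (A : SL(2, ℤ)) (m : ℤ) (n : ℕ) :
    ∑ k ∈ Finset.range n, shearCoord h (fan A ((k : ℤ) + m + 1))
      = fanLog h A (n + m) - fanLog h A m := by
  have := Finset.sum_range_sub (fun k : ℕ => fanLog h A (k + m)) n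
  rw [Nat.cast_zero, zero_add] at this
  rw [← this]
  refine Finset.sum_congr rfl fun k _ => ?_
  rw [shearCoord_fan]
  push_cast
  rw [add_right_comm]

lemma sum_shearCoord_fan_neg (h : Circle ≃ₜ Circle) (A : SL(2, ℤ)) (n : ℕ) :
    ∑ k ∈ Finset.range n, shearCoord h (fan A (-((k : ℤ) + 1)))
      = fanLog h A (-1) - fanLog h A (-((n : ℤ) + 1)) := by
  have := Finset.sum_range_sub' (fun k : ℕ => fanLog h A (-((k : ℤ) + 1))) n
  rw [Nat.cast_zero, zero_add] at this
  rw [← this]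
  refine Finset.sum_congr rfl fun k _ => ?_
  have e := shearCoord_fan h A (-((k : ℤ) + 1 + 1))
  rw [show -((k : ℤ) + 1 + 1) + 1 = -((k : ℤ) + 1) by ring] at e
  rw [e]
  push_cast
  rfl

section Holder

variable {α : ℝ≥0} (hα : 0 < α) (hα' : α ≤ 1) {h : Circle ≃ₜ Circle} (hh : h ∈ holderClass α)
include hα hα' hh

lemma tendsto_sum_shearCoord_fan_neg (A : SL(2, ℤ)) :
    Tendsto (fun n : ℕ => ∑ k ∈ Finset.range n, shearCoord h (fan A (-((k : ℤ) + 1))))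
      atTop (𝓝 (fanLog h A (-1) + Real.log (circleDeriv h (vertex A)))) := by
  simp only [sum_shearCoord_fan_neg]
  rw [← sub_neg_eq_add]
  exact ((tendsto_fanLog hα hα' hh A).comp tendsto_neg_natCast_cofinite).const_sub _

lemma tendsto_sum_shearCoord_fan_pos (A : SL(2, ℤ)) (m : ℤ) :
    Tendsto (fun n : ℕ => ∑ k ∈ Finset.range n, shearCoord h (fan A ((k : ℤ) + m + 1)))
      atTop (𝓝 (-Real.log (circleDeriv h (vertex A)) - fanLog h A m)) := by
  simp only [sum_shearCoord_fan_pos]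
  have hm : Tendsto (fun n : ℕ => (n : ℤ) + m) atTop cofinite :=
    (add_left_injective m).tendsto_cofinite.comp tendsto_natCast_cofinite
  exact ((tendsto_fanLog hα hα' hh A).comp hm).sub_const _

lemma shearCoord_mem_classP : shearCoord h ∈ classP := by
  refine fun A => ⟨⟨_, tendsto_sum_shearCoord_fan_neg hα hα' hh A⟩,
    ⟨-Real.log (circleDeriv h (vertex A)) - fanLog h A (-1), ?_⟩⟩
  simpa using tendsto_sum_shearCoord_fan_pos hα hα' hh A (-1)

lemma pMinus_sub_pPlus (A : SL(2, ℤ)) :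
    pMinus (shearCoord h) A - pPlus (shearCoord h) A =
      fanLog h A (-1) + fanLog h A 0 + 2 * Real.log (circleDeriv h (vertex A)) := by
  have h1 := (tendsto_sum_shearCoord_fan_neg hα hα' hh A).limUnder_eq
  have h2 := tendsto_sum_shearCoord_fan_pos hα hα' hh A 0
  simp only [add_zero] at h2
  rw [pMinus, pPlus, h1, h2.limUnder_eq]
  ring

/-- The diamond shear of `h` on an edge `(a, c)` is half the logarithm of
`h'(a) h'(c) |a - c|² / |h(a) - h(c)|²`. -/
theorem diamond_shearCoord (A : SL(2, ℤ)) : diamond (shearCoord h) (toEdge A) =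
    1 / 2 * (Real.log (circleDeriv h (vertex A))
      + Real.log (circleDeriv h (vertex (A * ModularGroup.S)))
      - 2 * logQuot h (vertex A) (vertex (A * ModularGroup.S))) := by
  have f0 : ∀ B : SL(2, ℤ), fanVertex B 0 = vertex (B * ModularGroup.S) := fun B => by
    rw [fanVertex, zpow_zero, mul_one]
  -- The two outer vertices of the quad exchange indices when seen from the other endpoint. In the
  -- sum over both endpoints the four side terms then cancel, leaving four copies of the diagonal
  -- term.
  have f1 : fanVertex (A * ModularGroup.S) 1 = fanVertex A (-1) := by
    rw [fanVertex, fanVertex, vertex_eq_iff]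
    simp only [mul_T_zpow_mul_S_zero, mul_T_zpow_mul_S_one]
    simp [ModularGroup.coe_S, Matrix.SpecialLinearGroup.coe_mul, Matrix.mul_apply,
      Fin.sum_univ_two]
    ring
  have f2 : fanVertex (A * ModularGroup.S) (-1) = fanVertex A 1 := by
    rw [fanVertex, fanVertex, vertex_eq_iff]
    simp only [mul_T_zpow_mul_S_zero, mul_T_zpow_mul_S_one]
    simp [ModularGroup.coe_S, Matrix.SpecialLinearGroup.coe_mul, Matrix.mul_apply,
      Fin.sum_univ_two]
    ring
  have e1 := pMinus_sub_pPlus hα hα' hh A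
  have e2 := pMinus_sub_pPlus hα hα' hh (A * ModularGroup.S)
  simp only [fanLog, neg_add_cancel, zero_add, f0, f1, f2, mul_S_mul_S, vertex_neg] at e1 e2
  rw [diamond_toEdge, diamondAt, add_sub_assoc, e1, e2,
    logQuot_comm h (vertex (A * ModularGroup.S)) (vertex A),
    logQuot_comm h (vertex (A * ModularGroup.S)) (fanVertex A 1),
    logQuot_comm h (vertex A) (fanVertex A (-1))]
  ring

lemma exists_abs_diamond_le : ∃ C δ : ℝ, 0 < C ∧ 0 < δ ∧ ∀ e : fareyEdges, edgeLength e < δ →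
    |diamond (shearCoord h) e| ≤ C * edgeLength e ^ (α : ℝ) := by
  obtain ⟨C, δ, hC, hδ, hle⟩ := exists_abs_logQuot_sub_le hα hα' hh
  refine ⟨C, δ, hC, hδ, fun e he => ?_⟩
  have hne := vertex_ne_vertex_mul_S (rep e)
  have e1 := hle _ _ hne he
  have e2 := hle _ _ hne.symm (by rw [dist_comm]; exact he)
  rw [logQuot_comm, dist_comm] at e2
  change _ ≤ C * edgeLength e ^ (α : ℝ) at e1 e2
  have e3 := diamond_shearCoord hα hα' hh (rep e)
  rw [toEdge_rep] at e3
  rw [e3]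
  rw [abs_le] at e1 e2 ⊢
  constructor <;> linarith [e1.1, e1.2, e2.1, e2.2]

lemma mem_diamondClass (hα2 : 1 / 2 < α) : h ∈ diamondClass := by
  refine ⟨hh.1, shearCoord_mem_classP hα hα' hh, ?_⟩
  obtain ⟨C, δ, hC, hδ, hle⟩ := exists_abs_diamond_le hα hα' hh
  have hα3 : (1 : ℝ) < α * 2 := by
    have : ((1 / 2 : ℝ≥0) : ℝ) < α := by exact_mod_cast hα2
    push_cast at this
    linarith
  refine ((summable_edgeLength_rpow hα3).mul_left (C ^ 2)).of_norm_bounded_eventually ?_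
  -- The estimate holds only on short edges, but all except finitely many edges are short.
  filter_upwards [tendsto_edgeLength_cofinite.eventually (gt_mem_nhds hδ)] with e he
  have h1 := pow_le_pow_left₀ (abs_nonneg _) (hle e he) 2
  rw [sq_abs, mul_pow] at h1
  rw [Real.norm_eq_abs, abs_of_nonneg (sq_nonneg _), Real.rpow_mul (by exact dist_nonneg), Real.rpow_two]
  exact h1

end Holder

/-! ### A circle homeomorphism with a square root singularity -/

lemma abs_sqrt_sq_sub_sqrt_sq_le (a b : ℝ) : |√a ^ 2 - √b ^ 2| ≤ |a - b| := by
  rw [Real.sq_sqrt', Real.sq_sqrt']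
  exact abs_max_sub_max_le_abs a b 0

lemma abs_sqrt_sub_sqrt_le (a b : ℝ) : |√a - √b| ≤ √(|a - b|) := by
  apply Real.abs_le_sqrt
  refine le_trans ?_ (abs_sqrt_sq_sub_sqrt_sq_le a b)
  have ha := Real.sqrt_nonneg a
  have hb := Real.sqrt_nonneg b
  rw [sq_sub_sq, abs_mul, ← sq_abs, sq, abs_of_nonneg (add_nonneg ha hb)]
  refine mul_le_mul_of_nonneg_right ?_ (abs_nonneg _)
  rw [abs_le]
  constructor <;> linarith

/-- For `x, y` in `[0, 1]`, `x² + xy + y² ≤ 3/2 (x + y)`. Negative arguments are covered since `√`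
vanishes there. -/
lemma abs_sqrt_cube_sub_le {a b : ℝ} (ha : a ≤ 1) (hb : b ≤ 1) :
    |√a ^ 3 - √b ^ 3| ≤ 3 / 2 * |a - b| := by
  refine le_trans ?_ (mul_le_mul_of_nonneg_left (abs_sqrt_sq_sub_sqrt_sq_le a b) (by norm_num))
  have ha0 := Real.sqrt_nonneg a
  have hb0 := Real.sqrt_nonneg b
  have ha1 : √a ≤ 1 := Real.sqrt_le_one.2 ha
  have hb1 : √b ≤ 1 := Real.sqrt_le_one.2 hb
  generalize √a = x at *
  generalize √b = y at *
  rw [show x ^ 3 - y ^ 3 = (x ^ 2 + x * y + y ^ 2) * (x - y) by ring,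
    show x ^ 2 - y ^ 2 = (x + y) * (x - y) by ring, abs_mul, abs_mul, ← mul_assoc,
    abs_of_nonneg (by positivity : 0 ≤ x ^ 2 + x * y + y ^ 2), abs_of_nonneg (add_nonneg ha0 hb0)]
  refine mul_le_mul_of_nonneg_right ?_ (abs_nonneg _)
  nlinarith

lemma hasDerivAt_sqrt_cube (m : ℝ) : HasDerivAt (fun m => √m ^ 3) (3 / 2 * √m) m := by
  have hmul : ∀ m : ℝ, √m ^ 3 = m * √m := fun m => by
    rcases le_total 0 m with hm | hm
    · rw [pow_succ, Real.sq_sqrt hm]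
    · rw [Real.sqrt_eq_zero_of_nonpos hm]; simp
  rcases lt_trichotomy m 0 with hm | rfl | hm
  · rw [Real.sqrt_eq_zero_of_nonpos hm.le, mul_zero]
    refine (hasDerivAt_const m (0 : ℝ)).congr_of_eventuallyEq ?_
    filter_upwards [gt_mem_nhds hm] with x hx
    rw [Real.sqrt_eq_zero_of_nonpos (le_of_lt hx)]
    simp
  · rw [Real.sqrt_zero, mul_zero, hasDerivAt_iff_tendsto_slope]
    have h0 : Tendsto Real.sqrt (𝓝[≠] 0) (𝓝 0) := by
      have := Real.continuous_sqrt.tendsto 0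
      rw [Real.sqrt_zero] at this
      exact this.mono_left nhdsWithin_le_nhds
    refine h0.congr' ?_
    filter_upwards [self_mem_nhdsWithin] with x hx
    rw [slope_def_field, hmul, hmul, zero_mul, sub_zero, sub_zero, mul_div_cancel_left₀ _ hx]
  · refine ((Real.hasDerivAt_sqrt hm.ne').pow 3).congr_deriv ?_
    have h0 : √m ≠ 0 := (Real.sqrt_pos.2 hm).ne'
    push_cast
    field_simp

lemma abs_im_sub_im_le (z w : Circle) : |(z : ℂ).im - (w : ℂ).im| ≤ dist z w := by
  rw [← Complex.sub_im]
  exact (Complex.abs_im_le_norm _).trans_eq (dist_eq_norm (z : ℂ) w).symm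

lemma abs_re_sub_re_le (z w : Circle) : |(z : ℂ).re - (w : ℂ).re| ≤ dist z w := by
  rw [← Complex.sub_re]
  exact (Complex.abs_re_le_norm _).trans_eq (dist_eq_norm (z : ℂ) w).symm

lemma abs_re_le_one (z : Circle) : |(z : ℂ).re| ≤ 1 :=
  (Complex.abs_re_le_norm _).trans_eq (Circle.norm_coe z)

lemma neg_im_le_one (z : Circle) : -(z : ℂ).im ≤ 1 :=
  (neg_le_abs _).trans ((Complex.abs_im_le_norm _).trans_eq (Circle.norm_coe z))

/-- The angle by which `twist` rotates the point `z`. It vanishes on the upper half of the circle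
and behaves like the power `3 / 2` of the distance near `1` on the lower half. -/
noncomputable def twistAngle (z : Circle) : ℝ := √(-(z : ℂ).im) ^ 3 / 3

lemma abs_twistAngle_sub_le (z w : Circle) :
    |twistAngle z - twistAngle w| ≤ 1 / 2 * dist z w := by
  have h1 := abs_sqrt_cube_sub_le (neg_im_le_one z) (neg_im_le_one w)
  have h2 : |-(z : ℂ).im - -(w : ℂ).im| ≤ dist z w := by
    rw [neg_sub_neg, abs_sub_comm]
    exact abs_im_sub_im_le z w
  rw [twistAngle, twistAngle, ← sub_div, abs_div, abs_of_pos (by norm_num : (0 : ℝ) < 3)]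
  linarith

lemma twistAngle_of_im_nonneg {z : Circle} (hz : 0 ≤ (z : ℂ).im) : twistAngle z = 0 := by
  rw [twistAngle, Real.sqrt_eq_zero_of_nonpos (by linarith)]
  simp

lemma contractingWith_mul_exp_neg (w : Circle) :
    ContractingWith (1 / 2) fun z => w * Circle.exp (-twistAngle z) := by
  refine ⟨?_, LipschitzWith.of_dist_le_mul fun x y => ?_⟩
  · rw [← NNReal.coe_lt_coe]
    norm_num
  · have e : w * Circle.exp (-twistAngle x)
        = w * Circle.exp (-twistAngle y) * Circle.exp (twistAngle y - twistAngle x) := by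
      rw [mul_assoc, ← Circle.exp_add]
      congr 2
      ring
    rw [e]
    refine (dist_mul_exp_self_le _ _).trans ?_
    rw [abs_sub_comm]
    exact_mod_cast abs_twistAngle_sub_le x y

lemma continuous_twistAngle : Continuous twistAngle := by
  have : Continuous fun z : Circle => (z : ℂ).im := Complex.continuous_im.comp continuous_subtype_val
  unfold twistAngle
  fun_prop

/-- Solving `z exp(i φ(z)) = w` amounts to finding a fixed point of `z ↦ w exp(-i φ(z))`, a
contraction because the angle `φ` is `1/2`-Lipschitz. -/
lemma bijective_mul_exp_twistAngle :
    Function.Bijective fun z : Circle => z * Circle.exp (twistAngle z) := by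
  have key : ∀ z w : Circle, z * Circle.exp (twistAngle z) = w ↔
      Function.IsFixedPt (fun z => w * Circle.exp (-twistAngle z)) z := fun z w => by
    rw [Function.IsFixedPt, Circle.exp_neg, ← eq_mul_inv_iff_mul_eq, eq_comm]
  refine ⟨fun x y hxy => ?_, fun w => ?_⟩
  · exact (contractingWith_mul_exp_neg _).fixedPoint_unique' ((key x _).1 hxy) ((key y _).1 rfl)
  · exact ⟨_, (key _ w).2 (contractingWith_mul_exp_neg w).fixedPoint_isFixedPt⟩

/-- The circle homeomorphism `e ^ (iθ) ↦ e ^ (i (θ + max (0, -sin θ) ^ (3 / 2) / 3))`. -/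
noncomputable def twist : Circle ≃ₜ Circle :=
  Continuous.homeoOfEquivCompactToT2 (f := Equiv.ofBijective _ bijective_mul_exp_twistAngle)
    (continuous_id.mul (Circle.exp.continuous.comp continuous_twistAngle))

lemma twist_apply (z : Circle) : twist z = z * Circle.exp (twistAngle z) := rfl

lemma twist_of_im_nonneg {z : Circle} (hz : 0 ≤ (z : ℂ).im) : twist z = z := by
  rw [twist_apply, twistAngle_of_im_nonneg hz, Circle.exp_zero, mul_one]

lemma isNormalized_twist : IsNormalized twist := by
  intro z hz
  apply twist_of_im_nonneg
  rcases hz with h | h | h <;> simp [h]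

lemma hasDerivAt_coe_mul_exp (z : Circle) :
    HasDerivAt (fun t : ℝ => ((z * Circle.exp t : Circle) : ℂ)) (z * Complex.I) 0 := by
  have h1 : HasDerivAt (fun t : ℝ => (t : ℂ) * Complex.I) Complex.I 0 := by
    simpa using (Complex.ofRealCLM.hasDerivAt (x := (0 : ℝ))).mul_const Complex.I
  have h2 := (h1.cexp).const_mul (z : ℂ)
  simpa [Circle.coe_exp] using h2

lemma hasDerivAt_twistAngle_mul_exp (z : Circle) :
    HasDerivAt (fun t : ℝ => twistAngle (z * Circle.exp t))
      (-(1 / 2 * √(-(z : ℂ).im) * (z : ℂ).re)) 0 := by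
  have h1 := (Complex.imCLM.hasFDerivAt.comp_hasDerivAt 0 (hasDerivAt_coe_mul_exp z)).neg
  have h2 := (HasDerivAt.comp 0 (hasDerivAt_sqrt_cube _) h1).div_const 3
  refine (h2.congr_deriv ?_)
  simp
  ring

lemma hasDerivAt_twist_mul_exp (z : Circle) :
    HasDerivAt (fun t : ℝ => (twist (z * Circle.exp t) : ℂ))
      (z * Complex.I * (1 - 1 / 2 * √(-(z : ℂ).im) * (z : ℂ).re : ℝ)
        * (Circle.exp (twistAngle z) : ℂ)) 0 := by
  have h1 := hasDerivAt_coe_mul_exp z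
  have h2 := ((hasDerivAt_twistAngle_mul_exp z).ofReal_comp.mul_const Complex.I).cexp
  refine (h1.mul h2).congr_deriv ?_
  simp only [Circle.exp_zero, mul_one, Circle.coe_exp]
  push_cast
  ring

lemma half_le_one_sub_half_mul (z : Circle) :
    1 / 2 ≤ 1 - 1 / 2 * √(-(z : ℂ).im) * (z : ℂ).re := by
  have h1 := (abs_le.1 (abs_re_le_one z)).2
  have h2 : √(-(z : ℂ).im) ≤ 1 := Real.sqrt_le_one.2 (neg_im_le_one z)
  nlinarith [Real.sqrt_nonneg (-(z : ℂ).im)]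

lemma circleDeriv_twist (z : Circle) :
    circleDeriv twist z = 1 - 1 / 2 * √(-(z : ℂ).im) * (z : ℂ).re := by
  rw [circleDeriv, (hasDerivAt_twist_mul_exp z).deriv, norm_mul, norm_mul, norm_mul,
    Circle.norm_coe, Circle.norm_coe, Complex.norm_I, Complex.norm_real, Real.norm_eq_abs,
    abs_of_nonneg (by linarith [half_le_one_sub_half_mul z])]
  ring

lemma abs_log_sub_log_le {a b : ℝ} (ha : 1 / 2 ≤ a) (hb : 1 / 2 ≤ b) :
    |Real.log a - Real.log b| ≤ 2 * |a - b| := by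
  have key : ∀ {a b : ℝ}, 1 / 2 ≤ a → 1 / 2 ≤ b → Real.log a - Real.log b ≤ 2 * |a - b| := by
    intro a b ha hb
    have hb0 : 0 < b := by linarith
    rw [← Real.log_div (by linarith) hb0.ne']
    refine (Real.log_le_sub_one_of_pos (div_pos (by linarith) hb0)).trans ?_
    rw [div_sub_one hb0.ne', div_le_iff₀ hb0]
    nlinarith [le_abs_self (a - b), abs_nonneg (a - b)]
  rw [abs_le]
  have := key hb ha
  rw [abs_sub_comm] at this
  constructor <;> linarith [key ha hb]

lemma dist_le_two (z w : Circle) : dist z w ≤ 2 := by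
  refine (dist_eq_norm (z : ℂ) w).trans_le ((norm_sub_le _ _).trans ?_)
  rw [Circle.norm_coe, Circle.norm_coe]
  norm_num

/-- The derivative is at least `1/2`, where `log` is `2`-Lipschitz. The square root factor
contributes `√d` and the real part `d ≤ 2 √d`, in total `3 √d`. -/
lemma holderWith_log_circleDeriv_twist :
    HolderWith 3 (1 / 2) fun z : Circle => Real.log (circleDeriv twist z) := by
  have key : ∀ z w : Circle, dist (Real.log (circleDeriv twist z))
      (Real.log (circleDeriv twist w)) ≤ 3 * √(dist z w) := by
    intro z w
    rw [circleDeriv_twist, circleDeriv_twist, Real.dist_eq]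
    refine (abs_log_sub_log_le (half_le_one_sub_half_mul z) (half_le_one_sub_half_mul w)).trans ?_
    have h1 : |√(-(z : ℂ).im) - √(-(w : ℂ).im)| ≤ √(dist z w) := by
      refine (abs_sqrt_sub_sqrt_le _ _).trans (Real.sqrt_le_sqrt ?_)
      rw [neg_sub_neg, abs_sub_comm]
      exact abs_im_sub_im_le z w
    have h2 := abs_re_sub_re_le z w
    have h3 := abs_re_le_one z
    have h4 : √(-(w : ℂ).im) ≤ 1 := Real.sqrt_le_one.2 (neg_im_le_one w)
    have h5 := Real.sqrt_nonneg (-(w : ℂ).im)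
    have h6 : dist z w ≤ 2 * √(dist z w) := by
      have h7 := dist_le_two z w
      have h8 : √(dist z w) ≤ 2 := by
        rw [Real.sqrt_le_left zero_le_two]
        linarith
      nlinarith [Real.mul_self_sqrt (dist_nonneg (x := z) (y := w)), Real.sqrt_nonneg (dist z w)]
    generalize √(-(z : ℂ).im) = x at *
    generalize √(-(w : ℂ).im) = y at *
    have e : 1 - 1 / 2 * x * (z : ℂ).re - (1 - 1 / 2 * y * (w : ℂ).re)
        = -(1 / 2) * ((x - y) * (z : ℂ).re + y * ((z : ℂ).re - (w : ℂ).re)) := by ring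
    rw [e, abs_mul]
    have h9 : |(x - y) * (z : ℂ).re| ≤ |x - y| := by
      rw [abs_mul]
      exact mul_le_of_le_one_right (abs_nonneg _) h3
    have h10 : |y * ((z : ℂ).re - (w : ℂ).re)| ≤ dist z w := by
      rw [abs_mul, abs_of_nonneg h5]
      exact (mul_le_of_le_one_left (abs_nonneg _) h4).trans h2
    have h11 := abs_add_le ((x - y) * (z : ℂ).re) (y * ((z : ℂ).re - (w : ℂ).re))
    rw [abs_neg, abs_of_pos (by norm_num : (0 : ℝ) < 1 / 2)]
    linarith
  intro z w
  rw [edist_dist, edist_dist]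
  refine (ENNReal.ofReal_le_ofReal (key z w)).trans_eq ?_
  rw [ENNReal.ofReal_mul (by norm_num), Real.sqrt_eq_rpow,
    ← ENNReal.ofReal_rpow_of_nonneg dist_nonneg (by norm_num)]
  norm_num

lemma twist_mem_holderClass {α : ℝ≥0} (hα : α ≤ 1 / 2) : twist ∈ holderClass α := by
  refine ⟨isNormalized_twist, fun z => (hasDerivAt_twist_mul_exp z).differentiableAt,
    fun z => ?_, _, HolderWith.of_le (D := 2) (fun x y => ?_) holderWith_log_circleDeriv_twist hα⟩
  · rw [circleDeriv_twist]
    linarith [half_le_one_sub_half_mul z]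
  · rw [edist_dist]
    exact (ENNReal.ofReal_le_ofReal (dist_le_two x y)).trans_eq (by norm_num)

/-! ### The diamond shears of `twist` on the fan at `1` -/

lemma vertex_one : vertex 1 = 1 := by
  apply Circle.ext
  change (starRingEnd ℂ) _ / _ = _
  simp

lemma coe_fanVertex_one (n : ℤ) :
    (fanVertex 1 n : ℂ) = ((n : ℂ) - Complex.I) / ((n : ℂ) + Complex.I) := by
  change (starRingEnd ℂ) _ / _ = _
  simp only [mul_T_zpow_mul_S_zero, mul_T_zpow_mul_S_one]
  simp [sub_eq_add_neg]

lemma intCast_add_I_ne_zero (n : ℤ) : (n : ℂ) + Complex.I ≠ 0 := fun h => by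
  simpa using congrArg Complex.im h

lemma im_fanVertex_one (n : ℤ) : (fanVertex 1 n : ℂ).im = -(2 * n / ((n : ℝ) ^ 2 + 1)) := by
  rw [coe_fanVertex_one, Complex.div_im, Complex.normSq_apply]
  simp
  ring

/-- From `(n - i) e^{iy} - (n + i) e^{-iy} = 2i (n sin y - cos y)`. Being exact, it reduces the
quotients of `twist` to elementary estimates of sine and cosine. -/
lemma dist_fanVertex_one_mul_exp (n : ℤ) (y : ℝ) :
    dist (fanVertex 1 n * Circle.exp (2 * y)) 1
      = 2 * |n * Real.sin y - Real.cos y| / ‖(n : ℂ) + Complex.I‖ := by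
  have hw := intCast_add_I_ne_zero n
  change dist ((fanVertex 1 n : ℂ) * (Circle.exp (2 * y) : ℂ)) 1 = _
  rw [dist_eq_norm, coe_fanVertex_one, Circle.coe_exp]
  have hE : Complex.exp (y * Complex.I) ≠ 0 := Complex.exp_ne_zero _
  have h1 : Complex.exp ((2 * y : ℝ) * Complex.I)
      = Complex.exp (y * Complex.I) * Complex.exp (y * Complex.I) := by
    rw [← Complex.exp_add]
    congr 1
    push_cast
    ring
  have h2 : Complex.exp (y * Complex.I) * (Complex.cos y - Complex.sin y * Complex.I) = 1 := by
    have := Complex.exp_mul_I (-(y : ℂ))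
    rw [Complex.cos_neg, Complex.sin_neg] at this
    rw [sub_eq_add_neg, ← neg_mul, ← this, ← Complex.exp_add]
    simp
  have h3 : ((n : ℂ) - Complex.I) / ((n : ℂ) + Complex.I) * Complex.exp ((2 * y : ℝ) * Complex.I)
      - 1 = Complex.exp (y * Complex.I) * Complex.I
        * ((2 * (n * Real.sin y - Real.cos y) : ℝ) : ℂ) / ((n : ℂ) + Complex.I) := by
    rw [h1, eq_div_iff hw, sub_mul, div_mul_eq_mul_div, div_mul_cancel₀ _ hw]
    have h4 := Complex.exp_mul_I (y : ℂ)
    push_cast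
    linear_combination ((n : ℂ) - Complex.I) * Complex.exp (y * Complex.I) * h4
      + ((n : ℂ) + Complex.I) * h2
  rw [h3, norm_div, norm_mul, norm_mul, Complex.norm_exp_ofReal_mul_I, Complex.norm_I,
    Complex.norm_real, Real.norm_eq_abs, abs_mul, abs_two]
  ring

lemma dist_one_fanVertex_one (n : ℤ) :
    dist 1 (fanVertex 1 n) = 2 / ‖(n : ℂ) + Complex.I‖ := by
  have := dist_fanVertex_one_mul_exp n 0
  rw [mul_zero, Circle.exp_zero, mul_one] at this
  rw [dist_comm, this]
  simp

lemma logQuot_twist_fanVertex (n : ℤ) : logQuot twist 1 (fanVertex 1 n)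
    = Real.log |n * Real.sin (twistAngle (fanVertex 1 n) / 2)
      - Real.cos (twistAngle (fanVertex 1 n) / 2)| := by
  have h1 : twist 1 = 1 := isNormalized_twist 1 (Or.inl rfl)
  have h2 := dist_fanVertex_one_mul_exp n (twistAngle (fanVertex 1 n) / 2)
  rw [mul_div_cancel₀ _ two_ne_zero, ← twist_apply] at h2
  have h3 : ‖(n : ℂ) + Complex.I‖ ≠ 0 := norm_ne_zero_iff.2 (intCast_add_I_ne_zero n)
  rw [logQuot, h1, dist_one_fanVertex_one, dist_comm, h2]
  congr 1
  field_simp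

/-- With `r = √s ≈ √(2/n)`, `log h'` is about `-r/2` at the fan vertex while the log quotient is
about `-r/3`, so the diamond shear is about `½ (2/3 - 1/2) r = r / 12`. The explicit constants leave
`79/250 - 5/18 > 3/100`. -/
lemma le_diamond_twist_fan {n : ℕ} (hn : 50 ≤ n) :
    3 / 100 * √(1 / n) ≤ diamond (shearCoord twist) (fan 1 n) := by
  have hn' : (50 : ℝ) ≤ n := by exact_mod_cast hn
  have hform : diamond (shearCoord twist) (fan 1 n)
      = 1 / 2 * (Real.log (circleDeriv twist (fanVertex 1 n))
        - 2 * logQuot twist 1 (fanVertex 1 n)) := by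
    have h1 : circleDeriv twist 1 = 1 := by
      rw [circleDeriv_twist]
      simp
    rw [fan, diamond_shearCoord (α := 1 / 2) (by positivity) (by norm_num)
      (twist_mem_holderClass le_rfl), vertex_mul_T_zpow, vertex_one, h1, Real.log_one, zero_add,
      fanVertex]
  set c := fanVertex 1 n with hc
  set s : ℝ := 2 * n / ((n : ℝ) ^ 2 + 1) with hs
  have him : -(c : ℂ).im = s := by rw [hc, im_fanVertex_one]; simp [hs]
  have hs1 : 1 / n ≤ s := by
    rw [hs, div_le_div_iff₀ (by positivity) (by positivity)]
    nlinarith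
  have hs2 : s ≤ 1 / 25 := by
    rw [hs, div_le_div_iff₀ (by positivity) (by positivity)]
    nlinarith
  have hs3 : 48 / 25 ≤ n * s := by
    rw [hs, ← mul_div_assoc, div_le_div_iff₀ (by positivity) (by positivity)]
    nlinarith
  have hs4 : n * s ≤ 2 := by
    rw [hs, ← mul_div_assoc, div_le_iff₀ (by positivity)]
    nlinarith
  have hs0 : 0 < s := lt_of_lt_of_le (by positivity) hs1
  set r := √s with hr
  have hr0 : 0 < r := Real.sqrt_pos.2 hs0
  have hrs : r ^ 2 = s := Real.sq_sqrt hs0.le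
  have hr1 : r ≤ 1 / 5 := by
    rw [hr, Real.sqrt_le_left (by norm_num)]
    linarith
  have hderiv : 1 - r / 2 ≤ circleDeriv twist c := by
    rw [circleDeriv_twist, him, ← hr]
    have := (abs_le.1 (abs_re_le_one c)).2
    nlinarith
  have hlog1 : -(5 / 9) * r ≤ Real.log (circleDeriv twist c) := by
    have h0 : 0 < 1 - r / 2 := by linarith
    refine le_trans ?_ (Real.log_le_log h0 hderiv)
    refine le_trans ?_ (Real.one_sub_inv_le_log_of_pos h0)
    -- Equality holds at `r = 1/5`, the largest value allowed by `n ≥ 50`.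
    have : (1 - r / 2)⁻¹ ≤ 1 + 5 / 9 * r := by
      rw [inv_le_iff_one_le_mul₀ h0]
      nlinarith
    linarith
  set y := twistAngle c / 2 with hy
  have hyr : y = r ^ 3 / 6 := by
    rw [hy, twistAngle, him]
    ring
  have hny : n * y = n * s * r / 6 := by
    rw [hyr, ← hrs]
    ring
  have hy0 : 0 < y := by rw [hyr]; positivity
  have hny1 : n * y ≤ 1 / 15 := by rw [hny]; nlinarith
  have hy1 : y ≤ 1 / 15 := by nlinarith
  have hsin1 : Real.sin y ≤ y := Real.sin_le hy0.le
  have hsin2 : 99 / 100 * y ≤ Real.sin y := by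
    have h1 := Real.sin_ge_sub_cube hy0.le
    have h2 : y ^ 2 ≤ 1 / 225 := by nlinarith
    nlinarith
  have hnsin1 : n * Real.sin y ≤ 1 / 15 :=
    (mul_le_mul_of_nonneg_left hsin1 (by positivity)).trans hny1
  -- The constant is just below `(99/100) (48/25) / 6`.
  have hnsin2 : 79 / 250 * r ≤ n * Real.sin y := by
    have h1 : n * (99 / 100 * y) ≤ n * Real.sin y :=
      mul_le_mul_of_nonneg_left hsin2 (by positivity)
    nlinarith
  have hcos : 1 / 2 ≤ Real.cos y := by
    have := Real.one_sub_sq_div_two_le_cos (x := y)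
    nlinarith
  have habs : |n * Real.sin y - Real.cos y| = Real.cos y - n * Real.sin y := by
    rw [abs_sub_comm, abs_of_nonneg]
    linarith
  have hlog2 : logQuot twist 1 c ≤ -(n * Real.sin y) := by
    rw [hc, logQuot_twist_fanVertex, ← hc, ← hy, Int.cast_natCast, habs]
    refine (Real.log_le_sub_one_of_pos (by linarith)).trans ?_
    linarith [Real.cos_le_one y]
  have hsqrt : √(1 / n) ≤ r := Real.sqrt_le_sqrt hs1
  rw [hform]
  linarith

lemma not_summable_diamond_twist :
    ¬ Summable fun e : fareyEdges => diamond (shearCoord twist) e ^ 2 := by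
  intro h
  have h1 := h.comp_injective ((fan_injective 1).comp Nat.cast_injective)
  have h2 : Summable fun n : ℕ => (3 / 100 : ℝ) ^ 2 * ((n : ℝ))⁻¹ := by
    refine h1.of_norm_bounded_eventually_nat ?_
    filter_upwards [eventually_ge_atTop 50] with n hn
    have h3 := pow_le_pow_left₀ (by positivity) (le_diamond_twist_fan hn) 2
    rw [mul_pow, Real.sq_sqrt (by positivity), one_div] at h3
    rwa [Real.norm_of_nonneg (by positivity)]
  rw [summable_mul_left_iff (by norm_num)] at h2
  exact Real.not_summable_natCast_inv h2

end DiamondShear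

theorem mainTheorem2 (α : ℝ≥0) (hα : 0 < α) (hα' : α ≤ 1) :
    DiamondShear.holderClass α ⊆ DiamondShear.diamondClass ↔ 1 / 2 < α := by
  refine ⟨fun hsub => ?_, fun hα2 h hh => DiamondShear.mem_diamondClass hα hα' hh hα2⟩
  by_contra! hle
  exact DiamondShear.not_summable_diamond_twist
    (hsub (DiamondShear.twist_mem_holderClass hle)).2.2
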